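/- Let $\mathbb{O}$ denote the octonions, the $8$-dimensional real normed division algebra, with conjugation $u\mapsto\overline{u}$ and norm $|u|^2=\overline{u}u$. For $x,y\in\mathbb{O}^k$ put $\|x\|^2=\sum_{i=1}^k|x_i|^2$ and $(x,y)=\sum_{i=1}^k\overline{x_i}\,y_i\in\mathbb{O}$, and let $\mathrm{cs}_k^{\mathbb{O}}(x,y)=\|x\|^2\|y\|^2-|(x,y)|^2$, regarded as a quartic form in the $16k$ real coordinates of $(x,y)\in\mathbb{O}^k\times\mathbb{O}^k\cong\mathbb{R}^{16k}$. For a form $p$ of degree $2d$ on $\mathbb{R}^n$ let $p_{\min}$ and $p_{\max}$ be the minimum and the maximum of $p$ on the Euclidean unit sphere, let $p_{\min}^{\mathrm{sos}}$ be the supremum of all $\gamma\in\mathbb{R}$ such that $p(v)-\gamma\|v\|^{2d}$ is a sum of squares of polynomials, and, when $p_{\min}<p_{\max}$, let $$\mathrm{GAP}(p)=\frac{p_{\max}-p_{\min}^{\mathrm{sos}}}{p_{\max}-p_{\min}}.$$ Theorem. For every integer $k\ge 17$, $\mathrm{GAP}(\mathrm{cs}_k^{\mathbb{O}})>2$ (in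 particular $p_{\min}<p_{\max}$ and $p_{\min}^{\mathrm{sos}}$ is finite for $p=\mathrm{cs}_k^{\mathbb{O}}$). Moreover, $$q_k^{\mathbb{O}}(x,y)=\mathrm{cs}_k^{\mathbb{O}}(x,y)+\tfrac14\left(\|x\|^2+\|y\|^2\right)^2$$ is a convex quartic form in $16k$ real variables that is not a sum of squares of polynomials. (For $k=17$ this is an explicit convex quartic form in $272$ variables that is not a sum of squares.) -/

import Mathlib

/-- The octonions with coefficients in a commutative ring `R`, given by their coordinates with
respect to the units `e₀ = 1, e₁, …, e₇`. For `R = ℝ` this is the normed division algebra `𝕆`. Only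
the additive structure is the coordinatewise one; the product is `Octonion.mul`. -/
abbrev Octonion (R : Type*) : Type _ := Fin 8 → R

namespace Octonion

variable {R : Type*} [CommRing R]

/-- The matrix of right multiplication by the octonion `u`, in the basis `e₀, …, e₇`. -/
def rightMul (u : Octonion R) : Matrix (Fin 8) (Fin 8) R :=
  !![u 0, -u 1, -u 2, -u 3, -u 4, -u 5, -u 6, -u 7;
     u 1,  u 0,  u 3, -u 2,  u 5, -u 4, -u 7,  u 6;
     u 2, -u 3,  u 0,  u 1,  u 6,  u 7, -u 4, -u 5;
     u 3,  u 2, -u 1,  u 0,  u 7, -u 6,  u 5, -u 4;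
     u 4, -u 5, -u 6, -u 7,  u 0,  u 1,  u 2,  u 3;
     u 5,  u 4, -u 7,  u 6, -u 1,  u 0, -u 3,  u 2;
     u 6,  u 7,  u 4, -u 5, -u 2,  u 3,  u 0, -u 1;
     u 7, -u 6,  u 5,  u 4, -u 3, -u 2,  u 1,  u 0]

/-- The octonion product `v u`. -/
def mul (v u : Octonion R) : Octonion R := (rightMul u).mulVec v

/-- Octonion conjugation. -/
def conj (u : Octonion R) : Octonion R :=
  ![u 0, -u 1, -u 2, -u 3, -u 4, -u 5, -u 6, -u 7]

/-- The squared norm `|u|²`, the sum of the squares of the eight coordinates. -/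
def normSq (u : Octonion R) : R := ∑ i, u i ^ 2

/-- The squared norm satisfies `ū u = |u|² e₀`. -/
theorem conj_mul_self (u : Octonion R) : mul (conj u) u = ![normSq u, 0, 0, 0, 0, 0, 0, 0] := by
  funext i
  fin_cases i <;>
    simp [mul, conj, normSq, rightMul, Matrix.mulVec, dotProduct, Fin.sum_univ_eight] <;> ring

/-- The squared norm is multiplicative: this is a composition algebra. -/
theorem normSq_mul (v u : Octonion R) : normSq (mul v u) = normSq v * normSq u := by
  simp [mul, normSq, rightMul, Matrix.mulVec, dotProduct, Fin.sum_univ_eight]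
  ring

/-- `‖x‖² = ∑ |xᵢ|²` for a vector `x` of octonions. -/
def vecNormSq {k : ℕ} (x : Fin k → Octonion R) : R :=
  ∑ i, normSq (x i)

/-- `(x, y) = ∑ x̄ᵢ yᵢ`, an octonion, for vectors `x`, `y` of octonions. -/
def pairing {k : ℕ} (x y : Fin k → Octonion R) : Octonion R :=
  ∑ i, mul (conj (x i)) (y i)

/-- The octonionic Cauchy-Schwarz expression `‖x‖² ‖y‖² - |(x, y)|²`. -/
def cauchySchwarz {k : ℕ} (x y : Fin k → Octonion R) : R :=
  vecNormSq x * vecNormSq y - normSq (pairing x y)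

end Octonion

/-- The index set of the real variables: the coordinates of `x` and those of `y`, for
`(x, y)` in `𝕆ᵏ × 𝕆ᵏ`. -/
abbrev Vars (k : ℕ) : Type := (Fin k × Fin 8) ⊕ (Fin k × Fin 8)

/-- The vector `x` of generic octonions, with polynomial variables as coordinates. -/
noncomputable def xVec (k : ℕ) : Fin k → Octonion (MvPolynomial (Vars k) ℝ) :=
  fun i c => MvPolynomial.X (Sum.inl (i, c))

/-- The vector `y` of generic octonions, with polynomial variables as coordinates. -/
noncomputable def yVec (k : ℕ) : Fin k → Octonion (MvPolynomial (Vars k) ℝ) :=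
  fun i c => MvPolynomial.X (Sum.inr (i, c))

/-- The octonionic Cauchy-Schwarz form `cs_k(x, y) = ‖x‖² ‖y‖² - |(x, y)|²`, as a polynomial in
the real coordinates of `x` and `y`. -/
noncomputable def csForm (k : ℕ) : MvPolynomial (Vars k) ℝ :=
  Octonion.cauchySchwarz (xVec k) (yVec k)

/-- The values of `csForm k` are those of the Cauchy-Schwarz expression over `𝕆`. -/
theorem eval_csForm (k : ℕ) (v : Vars k → ℝ) :
    MvPolynomial.eval v (csForm k) =
      Octonion.cauchySchwarz (fun i c => v (Sum.inl (i, c))) (fun i c => v (Sum.inr (i, c))) := by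
  simp [csForm, xVec, yVec, Octonion.cauchySchwarz, Octonion.vecNormSq, Octonion.pairing,
    Octonion.normSq, Octonion.mul, Octonion.conj, Octonion.rightMul,
    Fin.sum_univ_eight]

/-- The form `q_k(x, y) = cs_k(x, y) + (1/4) (‖x‖² + ‖y‖²)²`. -/
noncomputable def qForm (k : ℕ) : MvPolynomial (Vars k) ℝ :=
  csForm k + MvPolynomial.C (1 / 4) *
    (Octonion.vecNormSq (xVec k) + Octonion.vecNormSq (yVec k)) ^ 2

section Sphere

variable {σ : Type*} [Fintype σ]

/-- The set of values of `p` on the Euclidean unit sphere. -/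
def sphereValues (p : MvPolynomial σ ℝ) : Set ℝ :=
  {t | ∃ v : σ → ℝ, ∑ i, v i ^ 2 = 1 ∧ MvPolynomial.eval v p = t}

/-- The set of all `γ` such that `p - γ ‖v‖^(2 d)` is a sum of squares of polynomials. -/
def sosLevels (d : ℕ) (p : MvPolynomial σ ℝ) : Set ℝ :=
  {γ | IsSumSq (p - MvPolynomial.C γ * (∑ i, MvPolynomial.X i ^ 2) ^ d)}

/-- `p_min`, the minimum of `p` on the unit sphere. -/
noncomputable def sphereMin (p : MvPolynomial σ ℝ) : ℝ := sInf (sphereValues p)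

/-- `p_max`, the maximum of `p` on the unit sphere. -/
noncomputable def sphereMax (p : MvPolynomial σ ℝ) : ℝ := sSup (sphereValues p)

/-- `p_min^sos`, the sum-of-squares lower bound on the minimum on the unit sphere of a form `p` of
degree `2 d`. -/
noncomputable def sosMin (d : ℕ) (p : MvPolynomial σ ℝ) : ℝ := sSup (sosLevels d p)

/-- `GAP(p) = (p_max - p_min^sos) / (p_max - p_min)` for a form `p` of degree `2 d`. -/
noncomputable def gap (d : ℕ) (p : MvPolynomial σ ℝ) : ℝ :=
  (sphereMax p - sosMin d p) / (sphereMax p - sphereMin p)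

end Sphere

/-! Since `csForm k` has minimum 0 and maximum 1/4 on the sphere, GAP > 2 means that the sos bound
lies strictly below -1/4, and `qForm k` is what must be a sum of squares for -1/4 to be an sos
level. So both non-sos claims follow from one upper bound on the sos levels.

That bound is a duality argument. The symmetric tensor `moment` defines a linear functional L on
quartics (`quarticFunctional`) that is nonnegative on squares of quadratic forms
(`momentForm_nonneg`), although it is negative on the nonnegative form `csForm k` for k > 1.
Evaluating it gives L(cs) / L(‖v‖⁴) = -2(k-1)/(7k+8), hence `le_of_mem_sosLevels_csForm`; this ratio
is below -1/4 exactly when k > 16.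

Positivity of L is checked on the blocks X, Y, Z (xx, yy and xy parts) of a symmetric matrix, each
cut into 8×8 blocks indexed by pairs i, j. For X and Y, the symmetric parts interact only through
traces, and the skew parts through the map K ↦ ∑ G K, with G = `conjMulGram`, which is 4 times an
isometry on skew 8×8 matrices (`sum_sq_conjMulGram_skew`, `mixed_block_nonneg`). The Z part reduces
to a Bessel inequality for the structure constants (`sum_mixedMoment_off_diag_nonneg`).

Convexity uses only 0 ≤ cs ≤ ‖v‖⁴/4: adding M‖v‖⁴ to any quartic form between 0 and M‖v‖⁴ gives a
convex form (`convexOn_add_norm_pow`). -/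

open Octonion

/-! ### Structure constants of x̄ y and their identities. -/

namespace Octonion

/-- The signs of the structure constants of `(x, y) ↦ x̄ y`. -/
def conjMulSign : Matrix (Fin 8) (Fin 8) ℤ :=
  !![ 1,  1,  1,  1,  1,  1,  1,  1;
     -1,  1,  1, -1,  1, -1, -1,  1;
     -1, -1,  1,  1,  1,  1, -1, -1;
     -1,  1, -1,  1,  1, -1,  1, -1;
     -1, -1, -1, -1,  1,  1,  1,  1;
     -1,  1, -1,  1, -1,  1, -1,  1;
     -1,  1,  1, -1, -1,  1,  1, -1;
     -1, -1,  1,  1, -1, -1,  1,  1]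

/-- The structure constants of `(x, y) ↦ x̄ y`: the coefficient of `x_a y_c` in `(x̄ y)_e`. -/
def conjMulCoeff (e a c : Fin 8) : ℤ := if a = e ^^^ c then conjMulSign e c else 0

/-- The inner product `⟨e̅ₐ e_c, e̅_b e_d⟩`. -/
def conjMulGram (a b c d : Fin 8) : ℤ :=
  if a ^^^ c = b ^^^ d then conjMulSign (a ^^^ c) c * conjMulSign (a ^^^ c) d else 0

theorem conjMulGram_eq_sum (a b c d : Fin 8) :
    conjMulGram a b c d = ∑ e, conjMulCoeff e a c * conjMulCoeff e b d := by
  revert a b c d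
  decide +kernel

/-- The polarised form of |x̄ y|² = |x|² |y|², on basis elements. -/
theorem conjMulGram_add_swap (a b c d : Fin 8) :
    conjMulGram a b c d + conjMulGram b a c d =
      2 * ((if a = b then 1 else 0) * (if c = d then 1 else 0)) := by
  revert a b c d
  decide +kernel

theorem conjMulGram_swap_swap (a b c d : Fin 8) :
    conjMulGram b a d c = conjMulGram a b c d := by
  simp only [conjMulGram_eq_sum, mul_comm]

/-- For a < b the 28 matrices `conjMulGram a b · ·` are skew, pairwise orthogonal and of equal norm,
so they span all skew 8×8 matrices. This is where dimension 8 enters the positivity proof. -/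
theorem sum_conjMulGram_mul (a b a' b' : Fin 8) :
    ∑ c, ∑ d, conjMulGram a b c d * conjMulGram a' b' c d =
      8 * ((if a = a' then 1 else 0) * (if b = b' then 1 else 0) -
        (if a = b' then 1 else 0) * (if b = a' then 1 else 0) +
        (if a = b then 1 else 0) * (if a' = b' then 1 else 0)) := by
  revert a b a' b'
  decide +kernel

theorem mul_conj_apply {R : Type*} [CommRing R] (x y : Octonion R) (e : Fin 8) :
    mul (conj x) y e = ∑ a, ∑ c, (conjMulCoeff e a c : R) * (x a * y c) := by
  have h : ∀ a, ∑ c, (conjMulCoeff e a c : R) * (x a * y c) =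
      (conjMulSign e (e ^^^ a) : R) * (x a * y (e ^^^ a)) := by
    intro a
    -- For fixed e and a exactly one c contributes, because xor is an involution.
    have h1 : ∀ c, (a = e ^^^ c) ↔ (c = e ^^^ a) := by
      revert a e; decide
    simp [conjMulCoeff, h1]
  simp only [h]
  fin_cases e <;>
    simp [mul, conj, rightMul, Matrix.mulVec, dotProduct, Fin.sum_univ_eight, conjMulSign] <;>
    ring

end Octonion

theorem sum_comm_pairs {α β γ δ : Type*} [Fintype α] [Fintype β] [Fintype γ] [Fintype δ]
    (f : α → β → γ → δ → ℝ) :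
    ∑ c, ∑ d, ∑ a, ∑ b, f a b c d = ∑ a, ∑ b, ∑ c, ∑ d, f a b c d := by
  have h := Finset.sum_comm (s := Finset.univ) (t := Finset.univ)
    (f := fun (u : γ × δ) (v : α × β) => f v.1 v.2 u.1 u.2)
  simpa only [Fintype.sum_prod_type] using h

/-! ### Inequalities for 8×8 blocks. -/

namespace Octonion

/-- Bessel's inequality: the eight coefficient matrices have disjoint supports and squared norm 8
each. -/
theorem sum_sq_conjMulCoeff_le (S : Fin 8 → Fin 8 → ℝ) :
    ∑ e, (∑ a, ∑ c, (conjMulCoeff e a c : ℝ) * S a c) ^ 2 ≤ 8 * ∑ a, ∑ c, S a c ^ 2 := by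
  -- The coefficients lie in {-1, 0, 1}, so Cauchy-Schwarz can be applied to c · (c² S); its factor
  -- c⁴ is the indicator of the support, and these indicators add up to 1 over e.
  have cube : ∀ e a c, (conjMulCoeff e a c : ℝ) =
      conjMulCoeff e a c * conjMulCoeff e a c * conjMulCoeff e a c := by
    intro e a c
    have : conjMulCoeff e a c = conjMulCoeff e a c * conjMulCoeff e a c * conjMulCoeff e a c := by
      revert e a c; decide
    exact_mod_cast this
  have norm : ∀ e, ∑ u : Fin 8 × Fin 8, (conjMulCoeff e u.1 u.2 : ℝ) ^ 2 = 8 := by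
    intro e
    have : ∑ u : Fin 8 × Fin 8, conjMulCoeff e u.1 u.2 ^ 2 = 8 := by
      revert e; decide +kernel
    exact_mod_cast this
  have one : ∀ u : Fin 8 × Fin 8, ∑ e, (conjMulCoeff e u.1 u.2 : ℝ) ^ 4 = 1 := by
    intro u
    have : ∑ e, conjMulCoeff e u.1 u.2 ^ 4 = 1 := by
      revert u; decide +kernel
    exact_mod_cast this
  have bound : ∀ e, (∑ a, ∑ c, (conjMulCoeff e a c : ℝ) * S a c) ^ 2 ≤
      8 * ∑ u : Fin 8 × Fin 8, (conjMulCoeff e u.1 u.2 : ℝ) ^ 4 * S u.1 u.2 ^ 2 := by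
    intro e
    have h := Finset.sum_mul_sq_le_sq_mul_sq Finset.univ
      (fun u : Fin 8 × Fin 8 => (conjMulCoeff e u.1 u.2 : ℝ))
      (fun u => (conjMulCoeff e u.1 u.2 : ℝ) * conjMulCoeff e u.1 u.2 * S u.1 u.2)
    rw [norm] at h
    have l : ∑ a, ∑ c, (conjMulCoeff e a c : ℝ) * S a c =
        ∑ u : Fin 8 × Fin 8, (conjMulCoeff e u.1 u.2 : ℝ) *
          (conjMulCoeff e u.1 u.2 * conjMulCoeff e u.1 u.2 * S u.1 u.2) := by
      rw [Fintype.sum_prod_type]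
      refine Finset.sum_congr rfl fun a _ => Finset.sum_congr rfl fun c _ => ?_
      linear_combination S a c * cube e a c
    rw [l]
    refine h.trans_eq (congrArg _ (Finset.sum_congr rfl fun u _ => by ring))
  refine (Finset.sum_le_sum fun e _ => bound e).trans_eq ?_
  rw [← Finset.mul_sum, Finset.sum_comm]
  simp only [← Finset.sum_mul, one, one_mul, Fintype.sum_prod_type]

theorem conjMulGram_add_swap_real (a b c d : Fin 8) :
    (conjMulGram a b c d : ℝ) + conjMulGram b a c d =
      2 * ((if a = b then 1 else 0) * (if c = d then 1 else 0)) := by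
  exact_mod_cast conjMulGram_add_swap a b c d

/-- By polarised norm multiplicativity, a symmetric X is seen by the Gram form only through its
trace. -/
theorem sum_conjMulGram_transpose_left (X Y : Fin 8 → Fin 8 → ℝ) :
    ∑ a, ∑ b, ∑ c, ∑ d, (conjMulGram a b c d : ℝ) * X b a * Y c d =
      2 * (∑ a, X a a) * (∑ c, Y c c) -
        ∑ a, ∑ b, ∑ c, ∑ d, (conjMulGram a b c d : ℝ) * X a b * Y c d := by
  rw [Finset.sum_comm, eq_sub_iff_add_eq]
  simp only [← Finset.sum_add_distrib]
  have h : ∀ a b c d, (conjMulGram b a c d : ℝ) * X a b * Y c d +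
      conjMulGram a b c d * X a b * Y c d =
      2 * ((if a = b then 1 else 0) * (if c = d then 1 else 0)) * (X a b * Y c d) := by
    intro a b c d
    rw [← conjMulGram_add_swap_real]
    ring
  simp only [h]
  rw [mul_assoc, Finset.sum_mul_sum]
  simp [Finset.mul_sum]

theorem sum_conjMulGram_transpose_transpose (X Y : Fin 8 → Fin 8 → ℝ) :
    ∑ a, ∑ b, ∑ c, ∑ d, (conjMulGram a b c d : ℝ) * X b a * Y d c =
      ∑ a, ∑ b, ∑ c, ∑ d, (conjMulGram a b c d : ℝ) * X a b * Y c d := by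
  rw [Finset.sum_comm]
  refine Finset.sum_congr rfl fun a _ => Finset.sum_congr rfl fun b _ => ?_
  rw [Finset.sum_comm]
  simp only [conjMulGram_swap_swap]

theorem sum_sq_conjMulGram_skew (K : Fin 8 → Fin 8 → ℝ) (hK : ∀ a b, K b a = -K a b) :
    ∑ c, ∑ d, (∑ a, ∑ b, (conjMulGram a b c d : ℝ) * K a b) ^ 2 =
      16 * ∑ a, ∑ b, K a b ^ 2 := by
  have diag : ∀ a, K a a = 0 := fun a => by linarith [hK a a]
  have gram : ∀ u v : Fin 8 × Fin 8,
      ∑ w : Fin 8 × Fin 8, (conjMulGram u.1 u.2 w.1 w.2 : ℝ) * conjMulGram v.1 v.2 w.1 w.2 =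
      8 * ((if u.1 = v.1 then 1 else 0) * (if u.2 = v.2 then 1 else 0) -
        (if u.1 = v.2 then 1 else 0) * (if u.2 = v.1 then 1 else 0) +
        (if u.1 = u.2 then 1 else 0) * (if v.1 = v.2 then 1 else 0)) := by
    intro u v
    rw [Fintype.sum_prod_type]
    exact_mod_cast sum_conjMulGram_mul u.1 u.2 v.1 v.2
  calc ∑ c, ∑ d, (∑ a, ∑ b, (conjMulGram a b c d : ℝ) * K a b) ^ 2
      = ∑ w : Fin 8 × Fin 8, ∑ u : Fin 8 × Fin 8, ∑ v : Fin 8 × Fin 8,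
          (conjMulGram u.1 u.2 w.1 w.2 : ℝ) * conjMulGram v.1 v.2 w.1 w.2 *
            (K u.1 u.2 * K v.1 v.2) := by
        rw [Fintype.sum_prod_type]
        refine Finset.sum_congr rfl fun c _ => Finset.sum_congr rfl fun d _ => ?_
        rw [← Fintype.sum_prod_type', sq, Finset.sum_mul_sum]
        exact Finset.sum_congr rfl fun u _ => Finset.sum_congr rfl fun v _ => by ring
    _ = ∑ u : Fin 8 × Fin 8, ∑ v : Fin 8 × Fin 8, (∑ w : Fin 8 × Fin 8,
          (conjMulGram u.1 u.2 w.1 w.2 : ℝ) * conjMulGram v.1 v.2 w.1 w.2) *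
            (K u.1 u.2 * K v.1 v.2) := by
        rw [Finset.sum_comm]
        refine Finset.sum_congr rfl fun u _ => ?_
        rw [Finset.sum_comm]
        simp only [Finset.sum_mul]
    _ = ∑ u : Fin 8 × Fin 8, 16 * K u.1 u.2 ^ 2 := by
        refine Finset.sum_congr rfl fun u _ => ?_
        simp only [gram, Fintype.sum_prod_type]
        simp only [mul_add, mul_sub, add_mul, sub_mul, Finset.sum_add_distrib,
          Finset.sum_sub_distrib]
        simp [diag, hK u.1 u.2]
        ring
    _ = _ := by rw [Fintype.sum_prod_type]; simp only [Finset.mul_sum]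

/-- Split X and Y into symmetric and skew parts. The Gram form is a trace product plus a coupling of
the skew parts. The coupling is absorbed by the skew norms, and the traces complete to 6 (tr X + tr
Y)². -/
theorem mixed_block_nonneg (X Y : Fin 8 → Fin 8 → ℝ) :
    0 ≤ (12 * ∑ a, ∑ b, X a b ^ 2 + 4 * ∑ a, ∑ b, X a b * X b a + 4 * (∑ a, X a a) ^ 2) +
      (12 * ∑ a, ∑ b, Y a b ^ 2 + 4 * ∑ a, ∑ b, Y a b * Y b a + 4 * (∑ a, Y a a) ^ 2) +
      (8 * ((∑ a, X a a) * ∑ a, Y a a) +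
        4 * ∑ a, ∑ b, ∑ c, ∑ d, (conjMulGram a b c d : ℝ) * X a b * Y c d) := by
  have swap : ∀ Z : Fin 8 → Fin 8 → ℝ, ∑ a, ∑ b, Z b a ^ 2 = ∑ a, ∑ b, Z a b ^ 2 :=
    fun Z => Finset.sum_comm
  have decomp : ∀ Z : Fin 8 → Fin 8 → ℝ,
      12 * ∑ a, ∑ b, Z a b ^ 2 + 4 * ∑ a, ∑ b, Z a b * Z b a =
        2 * ∑ a, ∑ b, (Z a b - Z b a) ^ 2 + 4 * ∑ a, ∑ b, (Z a b + Z b a) ^ 2 := by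
    intro Z
    simp only [add_sq, sub_sq, Finset.sum_add_distrib, Finset.sum_sub_distrib, mul_assoc,
      ← Finset.mul_sum]
    rw [swap Z]
    ring
  have trace : ∀ Z : Fin 8 → Fin 8 → ℝ,
      (∑ a, Z a a) ^ 2 ≤ 2 * ∑ a, ∑ b, (Z a b + Z b a) ^ 2 := by
    intro Z
    have h1 := sq_sum_le_card_mul_sum_sq (s := Finset.univ) (f := fun a => Z a a)
    have h2 : ∑ a, (Z a a + Z a a) ^ 2 ≤ ∑ a, ∑ b, (Z a b + Z b a) ^ 2 :=
      Finset.sum_le_sum fun a _ =>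
        Finset.single_le_sum (f := fun b => (Z a b + Z b a) ^ 2) (fun b _ => sq_nonneg _)
          (Finset.mem_univ a)
    have h3 : ∑ a, (Z a a + Z a a) ^ 2 = 4 * ∑ a, Z a a ^ 2 := by
      rw [Finset.mul_sum]; exact Finset.sum_congr rfl fun a _ => by ring
    simp only [Finset.card_univ, Fintype.card_fin, Nat.cast_ofNat] at h1
    linarith
  have skew := sum_sq_conjMulGram_skew (fun a b => X a b - X b a) (fun a b => by ring)
  have cross : ∑ c, ∑ d, (∑ a, ∑ b, (conjMulGram a b c d : ℝ) * (X a b - X b a)) *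
        (Y c d - Y d c) =
      4 * ∑ a, ∑ b, ∑ c, ∑ d, (conjMulGram a b c d : ℝ) * X a b * Y c d -
        4 * ((∑ a, X a a) * ∑ a, Y a a) := by
    have e : ∑ c, ∑ d, (∑ a, ∑ b, (conjMulGram a b c d : ℝ) * (X a b - X b a)) *
        (Y c d - Y d c) = ∑ a, ∑ b, ∑ c, ∑ d, (conjMulGram a b c d : ℝ) * (X a b - X b a) *
        (Y c d - Y d c) := by
      simp only [Finset.sum_mul]
      exact sum_comm_pairs _
    rw [e]
    simp only [mul_sub, sub_mul, Finset.sum_sub_distrib]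
    have h1 := sum_conjMulGram_transpose_left X Y
    have h2 := sum_conjMulGram_transpose_transpose X Y
    have h3 := sum_conjMulGram_transpose_left X (fun c d => Y d c)
    linarith
  -- The weight 4 matches the factor 16 = 4² of `sum_sq_conjMulGram_skew`, so an eighth of this
  -- square is exactly the skew part of the claim.
  have square : 0 ≤ ∑ c, ∑ d, ((∑ a, ∑ b, (conjMulGram a b c d : ℝ) * (X a b - X b a)) +
      4 * (Y c d - Y d c)) ^ 2 := by positivity
  have expand : ∀ M N : Fin 8 → Fin 8 → ℝ, ∑ c, ∑ d, (M c d + 4 * N c d) ^ 2 =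
      ∑ c, ∑ d, M c d ^ 2 + 8 * (∑ c, ∑ d, M c d * N c d) + 16 * ∑ c, ∑ d, N c d ^ 2 := by
    intro M N
    simp only [Finset.mul_sum, ← Finset.sum_add_distrib]
    exact Finset.sum_congr rfl fun c _ => Finset.sum_congr rfl fun d _ => by ring
  rw [expand, skew, cross] at square
  linarith [decomp X, decomp Y, trace X, trace Y, sq_nonneg ((∑ a, X a a) + ∑ a, Y a a)]

end Octonion

/-! ### The pseudo-moment tensor and its symmetries. -/

section Tensors

variable {ι : Type*} [DecidableEq ι]

/-- The Kronecker delta. -/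
def kronecker {α : Type*} [DecidableEq α] (a b : α) : ℝ := if a = b then 1 else 0

theorem kronecker_comm {α : Type*} [DecidableEq α] (a b : α) : kronecker a b = kronecker b a := by
  simp [kronecker, eq_comm]

/-- The values of the pseudo-moment functional on quartic monomials in one vector. -/
def pureMoment (p q r s : ι × Fin 8) : ℝ :=
  6 * (kronecker p q * kronecker r s + kronecker p r * kronecker q s +
    kronecker p s * kronecker q r) +
  2 * (kronecker p.1 q.1 * kronecker r.1 s.1 *
      (kronecker p.2 r.2 * kronecker q.2 s.2 + kronecker p.2 s.2 * kronecker q.2 r.2) +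
    kronecker p.1 r.1 * kronecker q.1 s.1 *
      (kronecker p.2 q.2 * kronecker r.2 s.2 + kronecker p.2 s.2 * kronecker q.2 r.2) +
    kronecker p.1 s.1 * kronecker q.1 r.1 *
      (kronecker p.2 q.2 * kronecker r.2 s.2 + kronecker p.2 r.2 * kronecker q.2 s.2))

/-- The values of the pseudo-moment functional on biquadratic monomials: `p`, `q` index
coordinates of `x` and `r`, `s` coordinates of `y`. -/
def mixedMoment (p q r s : ι × Fin 8) : ℝ :=
  4 * (kronecker p q * kronecker r s) +
  kronecker p.1 r.1 * kronecker q.1 s.1 *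
    (2 * (kronecker p.2 q.2 * kronecker r.2 s.2) + conjMulGram p.2 q.2 r.2 s.2) +
  kronecker p.1 s.1 * kronecker q.1 r.1 *
    (2 * (kronecker p.2 q.2 * kronecker r.2 s.2) + conjMulGram q.2 p.2 r.2 s.2)

/-- The pseudo-moment functional on quartic monomials. -/
def moment : (ι × Fin 8) ⊕ (ι × Fin 8) → (ι × Fin 8) ⊕ (ι × Fin 8) →
    (ι × Fin 8) ⊕ (ι × Fin 8) → (ι × Fin 8) ⊕ (ι × Fin 8) → ℝ
  | .inl p, .inl q, .inl r, .inl s => pureMoment p q r s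
  | .inr p, .inr q, .inr r, .inr s => pureMoment p q r s
  | .inl p, .inl q, .inr r, .inr s => mixedMoment p q r s
  | .inr r, .inr s, .inl p, .inl q => mixedMoment p q r s
  | .inl p, .inr r, .inl q, .inr s => mixedMoment p q r s
  | .inl p, .inr r, .inr s, .inl q => mixedMoment p q r s
  | .inr r, .inl p, .inl q, .inr s => mixedMoment p q r s
  | .inr r, .inl p, .inr s, .inl q => mixedMoment p q r s
  | _, _, _, _ => 0

theorem pureMoment_swap_mid (p q r s : ι × Fin 8) : pureMoment p r q s = pureMoment p q r s := by
  simp only [pureMoment, kronecker_comm r q, kronecker_comm r.1 q.1, kronecker_comm r.2 q.2]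
  ring

theorem pureMoment_swap_right (p q r s : ι × Fin 8) : pureMoment p q s r = pureMoment p q r s := by
  simp only [pureMoment, kronecker_comm s r, kronecker_comm s.1 r.1, kronecker_comm s.2 r.2]
  ring

theorem mixedMoment_swap_left (p q r s : ι × Fin 8) :
    mixedMoment q p r s = mixedMoment p q r s := by
  simp only [mixedMoment, kronecker_comm q p, kronecker_comm q.2 p.2]
  ring

theorem mixedMoment_swap_right (p q r s : ι × Fin 8) :
    mixedMoment p q s r = mixedMoment p q r s := by
  simp only [mixedMoment, kronecker_comm s r, kronecker_comm s.2 r.2,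
    ← conjMulGram_swap_swap p.2 q.2 s.2, ← conjMulGram_swap_swap q.2 p.2 s.2]
  ring

/-- Swapping slots 2, 3 and swapping slots 3, 4 permute the three pairings of four indices
transitively, which is all the symmetry needed to evaluate the functional on squares. -/
theorem moment_swap_mid (p q r s : (ι × Fin 8) ⊕ (ι × Fin 8)) :
    moment p r q s = moment p q r s := by
  rcases p with p | p <;> rcases q with q | q <;> rcases r with r | r <;> rcases s with s | s <;>
    simp only [moment, pureMoment_swap_mid p q, mixedMoment_swap_left q r,
      mixedMoment_swap_right _ _ q r]

theorem moment_swap_right (p q r s : (ι × Fin 8) ⊕ (ι × Fin 8)) :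
    moment p q s r = moment p q r s := by
  rcases p with p | p <;> rcases q with q | q <;> rcases r with r | r <;> rcases s with s | s <;>
    simp only [moment, pureMoment_swap_right _ _ r s, mixedMoment_swap_left r s,
      mixedMoment_swap_right _ _ r s]

end Tensors

/-! ### Contracting the pure tensor with a symmetric matrix. -/

section Contractions

variable {ι : Type*} [Fintype ι]

theorem sum_pairs_eq (f : ι × Fin 8 → ι × Fin 8 → ℝ) :
    ∑ p, ∑ q, f p q = ∑ i, ∑ j, ∑ a, ∑ b, f (i, a) (j, b) := by
  simp only [Fintype.sum_prod_type]
  exact Finset.sum_congr rfl fun i _ => Finset.sum_comm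

theorem sum_pair_comm {α β γ : Type*} [Fintype α] [Fintype β] [Fintype γ] (f : α → β → γ → ℝ) :
    ∑ a, ∑ b, ∑ c, f a b c = ∑ c, ∑ a, ∑ b, f a b c := by
  exact (Finset.sum_congr rfl fun a _ => Finset.sum_comm).trans Finset.sum_comm

variable [DecidableEq ι]

theorem sum_kronecker_mul {α : Type*} [Fintype α] [DecidableEq α] (p : α) (f : α → ℝ) :
    ∑ q, kronecker p q * f q = f p := by
  simp [kronecker]

theorem sum_kronecker_fst_mul (i : ι) (f : ι × Fin 8 → ℝ) :
    ∑ q, kronecker i q.1 * f q = ∑ b, f (i, b) := by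
  rw [Fintype.sum_prod_type_right]
  simp [kronecker]

theorem sum_kronecker_12_34 {α : Type*} [Fintype α] [DecidableEq α] (F : α → α → α → α → ℝ) :
    ∑ p, ∑ q, ∑ r, ∑ s, kronecker p q * kronecker r s * F p q r s = ∑ p, ∑ r, F p p r r := by
  simp only [mul_assoc, ← Finset.mul_sum, sum_kronecker_mul]

theorem sum_kronecker_13_24 {α : Type*} [Fintype α] [DecidableEq α] (F : α → α → α → α → ℝ) :
    ∑ p, ∑ q, ∑ r, ∑ s, kronecker p r * kronecker q s * F p q r s = ∑ p, ∑ q, F p q p q := by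
  simp only [mul_assoc, ← Finset.mul_sum, sum_kronecker_mul]

theorem sum_kronecker_14_23 {α : Type*} [Fintype α] [DecidableEq α] (F : α → α → α → α → ℝ) :
    ∑ p, ∑ q, ∑ r, ∑ s, kronecker p s * kronecker q r * F p q r s = ∑ p, ∑ q, F p q q p := by
  refine Eq.trans ?_ (sum_kronecker_13_24 fun p q r s => F p q s r)
  exact Finset.sum_congr rfl fun p _ => Finset.sum_congr rfl fun q _ => Finset.sum_comm

theorem sum_kronecker_fst_12_34 (F : ι × Fin 8 → ι × Fin 8 → ι × Fin 8 → ι × Fin 8 → ℝ) :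
    ∑ p, ∑ q, ∑ r, ∑ s, kronecker p.1 q.1 * kronecker r.1 s.1 * F p q r s =
      ∑ i, ∑ j, ∑ a, ∑ b, ∑ c, ∑ d, F (i, a) (i, b) (j, c) (j, d) := by
  simp only [mul_assoc, ← Finset.mul_sum, sum_kronecker_fst_mul]
  simp only [Fintype.sum_prod_type]
  refine Finset.sum_congr rfl fun i _ => ?_
  exact sum_pair_comm _

theorem sum_kronecker_fst_13_24 (F : ι × Fin 8 → ι × Fin 8 → ι × Fin 8 → ι × Fin 8 → ℝ) :
    ∑ p, ∑ q, ∑ r, ∑ s, kronecker p.1 r.1 * kronecker q.1 s.1 * F p q r s =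
      ∑ i, ∑ j, ∑ a, ∑ b, ∑ c, ∑ d, F (i, a) (j, b) (i, c) (j, d) := by
  simp only [mul_assoc, ← Finset.mul_sum, sum_kronecker_fst_mul]
  exact sum_pairs_eq _

theorem sum_kronecker_fst_14_23 (F : ι × Fin 8 → ι × Fin 8 → ι × Fin 8 → ι × Fin 8 → ℝ) :
    ∑ p, ∑ q, ∑ r, ∑ s, kronecker p.1 s.1 * kronecker q.1 r.1 * F p q r s =
      ∑ i, ∑ j, ∑ a, ∑ b, ∑ c, ∑ d, F (i, a) (j, b) (j, c) (i, d) := by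
  have h := sum_kronecker_fst_13_24 fun p q r s => F p q s r
  have l : ∀ f : ι × Fin 8 → ι × Fin 8 → ι × Fin 8 → ι × Fin 8 → ℝ,
      ∑ p, ∑ q, ∑ r, ∑ s, f p q r s = ∑ p, ∑ q, ∑ s, ∑ r, f p q r s := fun f =>
    Finset.sum_congr rfl fun p _ => Finset.sum_congr rfl fun q _ => Finset.sum_comm
  rw [l, h]
  exact Finset.sum_congr rfl fun i _ => Finset.sum_congr rfl fun j _ =>
    Finset.sum_congr rfl fun a _ => Finset.sum_congr rfl fun b _ => Finset.sum_comm

/-- Grouped by row pairs i, j so that the last sum has the block shape of `mixed_block_nonneg`; the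
other two terms are visibly nonnegative. -/
theorem sum_pureMoment (X : ι × Fin 8 → ι × Fin 8 → ℝ) (hX : ∀ p q, X q p = X p q) :
    ∑ p, ∑ q, ∑ r, ∑ s, pureMoment p q r s * (X p q * X r s) =
      6 * (∑ i, ∑ a, X (i, a) (i, a)) ^ 2 + 4 * ∑ a, ∑ b, (∑ i, X (i, a) (i, b)) ^ 2 +
      ∑ i, ∑ j, (12 * ∑ a, ∑ b, X (i, a) (j, b) ^ 2 +
        4 * ∑ a, ∑ b, X (i, a) (j, b) * X (i, b) (j, a) +
        4 * (∑ a, X (i, a) (j, a)) ^ 2) := by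
  have split : ∑ p, ∑ q, ∑ r, ∑ s, pureMoment p q r s * (X p q * X r s) =
      6 * (∑ p, ∑ q, ∑ r, ∑ s, kronecker p q * kronecker r s * (X p q * X r s)) +
      6 * (∑ p, ∑ q, ∑ r, ∑ s, kronecker p r * kronecker q s * (X p q * X r s)) +
      6 * (∑ p, ∑ q, ∑ r, ∑ s, kronecker p s * kronecker q r * (X p q * X r s)) +
      2 * (∑ p, ∑ q, ∑ r, ∑ s, kronecker p.1 q.1 * kronecker r.1 s.1 *
        (kronecker p.2 r.2 * kronecker q.2 s.2 * (X p q * X r s))) +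
      2 * (∑ p, ∑ q, ∑ r, ∑ s, kronecker p.1 q.1 * kronecker r.1 s.1 *
        (kronecker p.2 s.2 * kronecker q.2 r.2 * (X p q * X r s))) +
      2 * (∑ p, ∑ q, ∑ r, ∑ s, kronecker p.1 r.1 * kronecker q.1 s.1 *
        (kronecker p.2 q.2 * kronecker r.2 s.2 * (X p q * X r s))) +
      2 * (∑ p, ∑ q, ∑ r, ∑ s, kronecker p.1 r.1 * kronecker q.1 s.1 *
        (kronecker p.2 s.2 * kronecker q.2 r.2 * (X p q * X r s))) +
      2 * (∑ p, ∑ q, ∑ r, ∑ s, kronecker p.1 s.1 * kronecker q.1 r.1 *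
        (kronecker p.2 q.2 * kronecker r.2 s.2 * (X p q * X r s))) +
      2 * (∑ p, ∑ q, ∑ r, ∑ s, kronecker p.1 s.1 * kronecker q.1 r.1 *
        (kronecker p.2 r.2 * kronecker q.2 s.2 * (X p q * X r s))) := by
    simp only [Finset.mul_sum, ← Finset.sum_add_distrib]
    refine Finset.sum_congr rfl fun p _ => Finset.sum_congr rfl fun q _ =>
      Finset.sum_congr rfl fun r _ => Finset.sum_congr rfl fun s _ => ?_
    unfold pureMoment
    ring
  rw [split]
  simp only [sum_kronecker_fst_12_34, sum_kronecker_fst_13_24, sum_kronecker_fst_14_23]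
  simp only [sum_kronecker_12_34, sum_kronecker_13_24, sum_kronecker_14_23]
  have h1 : ∑ p, ∑ r, X p p * X r r = (∑ i, ∑ a, X (i, a) (i, a)) ^ 2 := by
    rw [← Fintype.sum_prod_type' (f := fun i a => X (i, a) (i, a)), sq, Finset.sum_mul_sum]
  have h2 : ∑ p, ∑ q, X p q * X p q = ∑ i, ∑ j, ∑ a, ∑ b, X (i, a) (j, b) ^ 2 := by
    simp only [← sq, sum_pairs_eq]
  have h3 : ∑ i, ∑ j, ∑ a, ∑ b, X (i, a) (i, b) * X (j, a) (j, b) =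
      ∑ a, ∑ b, (∑ i, X (i, a) (i, b)) ^ 2 := by
    rw [← sum_comm_pairs]
    simp only [sq, Finset.sum_mul_sum]
  have h4 : ∑ i, ∑ j, ∑ a, ∑ b, X (i, a) (j, a) * X (i, b) (j, b) =
      ∑ i, ∑ j, (∑ a, X (i, a) (j, a)) ^ 2 := by
    simp only [sq, Finset.sum_mul_sum]
  simp only [← Finset.mul_sum] at h1 h4
  simp only [hX _ _, Finset.sum_add_distrib, ← Finset.mul_sum]
  linarith

end Contractions

/-! ### Contracting the mixed tensor. -/

section MixedContractions

theorem sum_conjMulGram_eq (U V : Fin 8 → Fin 8 → ℝ) :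
    ∑ a, ∑ b, ∑ c, ∑ d, (conjMulGram a c b d : ℝ) * (U a b * V c d) =
      ∑ e, (∑ a, ∑ b, (conjMulCoeff e a b : ℝ) * U a b) *
        (∑ c, ∑ d, (conjMulCoeff e c d : ℝ) * V c d) := by
  have h : ∀ e, (∑ a, ∑ b, (conjMulCoeff e a b : ℝ) * U a b) *
        (∑ c, ∑ d, (conjMulCoeff e c d : ℝ) * V c d) =
      ∑ a, ∑ b, ∑ c, ∑ d, (conjMulCoeff e a b * conjMulCoeff e c d : ℝ) * (U a b * V c d) := by
    intro e
    simp only [Finset.sum_mul, Finset.mul_sum]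
    rw [sum_comm_pairs fun a b c d =>
      (conjMulCoeff e a b : ℝ) * U a b * (conjMulCoeff e c d * V c d)]
    refine Finset.sum_congr rfl fun a _ => Finset.sum_congr rfl fun b _ =>
      Finset.sum_congr rfl fun c _ => Finset.sum_congr rfl fun d _ => by ring
  simp only [h, conjMulGram_eq_sum, Int.cast_sum, Int.cast_mul, Finset.sum_mul]
  symm
  rw [Finset.sum_comm]
  refine Finset.sum_congr rfl fun a _ => ?_
  rw [Finset.sum_comm]
  refine Finset.sum_congr rfl fun b _ => ?_
  rw [Finset.sum_comm]
  refine Finset.sum_congr rfl fun c _ => ?_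
  rw [Finset.sum_comm]

variable {ι : Type*} [Fintype ι] [DecidableEq ι]

theorem sum_mixedMoment (X Y : ι × Fin 8 → ι × Fin 8 → ℝ) (hY : ∀ p q, Y q p = Y p q) :
    ∑ p, ∑ q, ∑ r, ∑ s, mixedMoment p q r s * (X p q * Y r s) =
      4 * ((∑ i, ∑ a, X (i, a) (i, a)) * ∑ i, ∑ a, Y (i, a) (i, a)) +
      ∑ i, ∑ j, (4 * ((∑ a, X (i, a) (j, a)) * ∑ a, Y (i, a) (j, a)) +
        2 * ∑ a, ∑ b, ∑ c, ∑ d,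
          (conjMulGram a b c d : ℝ) * X (i, a) (j, b) * Y (i, c) (j, d)) := by
  have split : ∑ p, ∑ q, ∑ r, ∑ s, mixedMoment p q r s * (X p q * Y r s) =
      4 * (∑ p, ∑ q, ∑ r, ∑ s, kronecker p q * kronecker r s * (X p q * Y r s)) +
      2 * (∑ p, ∑ q, ∑ r, ∑ s, kronecker p.1 r.1 * kronecker q.1 s.1 *
        (kronecker p.2 q.2 * kronecker r.2 s.2 * (X p q * Y r s))) +
      (∑ p, ∑ q, ∑ r, ∑ s, kronecker p.1 r.1 * kronecker q.1 s.1 *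
        ((conjMulGram p.2 q.2 r.2 s.2 : ℝ) * X p q * Y r s)) +
      2 * (∑ p, ∑ q, ∑ r, ∑ s, kronecker p.1 s.1 * kronecker q.1 r.1 *
        (kronecker p.2 q.2 * kronecker r.2 s.2 * (X p q * Y r s))) +
      (∑ p, ∑ q, ∑ r, ∑ s, kronecker p.1 s.1 * kronecker q.1 r.1 *
        ((conjMulGram q.2 p.2 r.2 s.2 : ℝ) * X p q * Y r s)) := by
    simp only [Finset.mul_sum, ← Finset.sum_add_distrib]
    refine Finset.sum_congr rfl fun p _ => Finset.sum_congr rfl fun q _ =>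
      Finset.sum_congr rfl fun r _ => Finset.sum_congr rfl fun s _ => ?_
    unfold mixedMoment
    ring
  -- The two matchings of rows contribute equally: Y is symmetric and G is unchanged when both of
  -- its index pairs are swapped.
  have gram : ∑ i, ∑ j, ∑ a, ∑ b, ∑ c, ∑ d,
        (conjMulGram b a c d : ℝ) * X (i, a) (j, b) * Y (j, c) (i, d) =
      ∑ i, ∑ j, ∑ a, ∑ b, ∑ c, ∑ d,
        (conjMulGram a b c d : ℝ) * X (i, a) (j, b) * Y (i, c) (j, d) := by
    refine Finset.sum_congr rfl fun i _ => Finset.sum_congr rfl fun j _ =>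
      Finset.sum_congr rfl fun a _ => Finset.sum_congr rfl fun b _ => ?_
    rw [Finset.sum_comm]
    refine Finset.sum_congr rfl fun c _ => Finset.sum_congr rfl fun d _ => ?_
    rw [hY (i, c), conjMulGram_swap_swap]
  have h1 : ∑ p, ∑ r, X p p * Y r r =
      (∑ i, ∑ a, X (i, a) (i, a)) * ∑ i, ∑ a, Y (i, a) (i, a) := by
    rw [← Fintype.sum_prod_type' (f := fun i a => X (i, a) (i, a)),
      ← Fintype.sum_prod_type' (f := fun i a => Y (i, a) (i, a)), Finset.sum_mul_sum]
  have h2 : ∀ i j, ∑ a, ∑ c, X (i, a) (j, a) * Y (i, c) (j, c) =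
      (∑ a, X (i, a) (j, a)) * ∑ a, Y (i, a) (j, a) :=
    fun i j => (Finset.sum_mul_sum _ _ _ _).symm
  have h3 : ∀ i j, ∑ a, ∑ c, X (i, a) (j, a) * Y (j, c) (i, c) =
      (∑ a, X (i, a) (j, a)) * ∑ a, Y (i, a) (j, a) := by
    intro i j
    simp only [hY (i, _) (j, _), h2]
  rw [split]
  simp only [sum_kronecker_fst_13_24, sum_kronecker_fst_14_23]
  simp only [sum_kronecker_12_34, gram, h1, h2, h3, Finset.sum_add_distrib]
  simp only [← Finset.mul_sum (s := (Finset.univ : Finset ι))]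
  ring

theorem sum_mixedMoment_off_diag (Z : ι × Fin 8 → ι × Fin 8 → ℝ) :
    ∑ p, ∑ q, ∑ r, ∑ s, mixedMoment p r q s * (Z p q * Z r s) =
      2 * ∑ a, ∑ b, (∑ i, Z (i, a) (i, b)) ^ 2 +
      ∑ e, (∑ i, ∑ a, ∑ b, (conjMulCoeff e a b : ℝ) * Z (i, a) (i, b)) ^ 2 +
      ∑ i, ∑ j, (4 * ∑ a, ∑ b, Z (i, a) (j, b) ^ 2 +
        4 * ∑ a, ∑ b, Z (i, a) (j, b) * Z (j, a) (i, b) -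
        ∑ e, (∑ a, ∑ b, (conjMulCoeff e a b : ℝ) * Z (i, a) (j, b)) *
          ∑ a, ∑ b, (conjMulCoeff e a b : ℝ) * Z (j, a) (i, b)) := by
  have split : ∑ p, ∑ q, ∑ r, ∑ s, mixedMoment p r q s * (Z p q * Z r s) =
      4 * (∑ p, ∑ q, ∑ r, ∑ s, kronecker p r * kronecker q s * (Z p q * Z r s)) +
      2 * (∑ p, ∑ q, ∑ r, ∑ s, kronecker p.1 q.1 * kronecker r.1 s.1 *
        (kronecker p.2 r.2 * kronecker q.2 s.2 * (Z p q * Z r s))) +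
      (∑ p, ∑ q, ∑ r, ∑ s, kronecker p.1 q.1 * kronecker r.1 s.1 *
        ((conjMulGram p.2 r.2 q.2 s.2 : ℝ) * (Z p q * Z r s))) +
      4 * (∑ p, ∑ q, ∑ r, ∑ s, kronecker p.1 s.1 * kronecker q.1 r.1 *
        (kronecker p.2 r.2 * kronecker q.2 s.2 * (Z p q * Z r s))) -
      (∑ p, ∑ q, ∑ r, ∑ s, kronecker p.1 s.1 * kronecker q.1 r.1 *
        ((conjMulGram p.2 r.2 q.2 s.2 : ℝ) * (Z p q * Z r s))) := by
    simp only [Finset.mul_sum, ← Finset.sum_add_distrib, ← Finset.sum_sub_distrib]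
    refine Finset.sum_congr rfl fun p _ => Finset.sum_congr rfl fun q _ =>
      Finset.sum_congr rfl fun r _ => Finset.sum_congr rfl fun s _ => ?_
    -- Polarisation rewrites the crossed term 2δδ + G(r, p, q, s) as 4δδ - G(p, r, q, s); both Gram
    -- terms then factor through the structure constants.
    have h := conjMulGram_add_swap_real p.2 r.2 q.2 s.2
    rw [show ((if p.2 = r.2 then 1 else 0 : ℝ)) = kronecker p.2 r.2 from rfl,
      show ((if q.2 = s.2 then 1 else 0 : ℝ)) = kronecker q.2 s.2 from rfl] at h
    unfold mixedMoment
    rw [kronecker_comm r.1 q.1]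
    linear_combination (kronecker p.1 s.1 * kronecker q.1 r.1) * (Z p q * Z r s) * h
  have h1 : ∑ p, ∑ q, Z p q * Z p q = ∑ i, ∑ j, ∑ a, ∑ b, Z (i, a) (j, b) ^ 2 := by
    simp only [← sq, sum_pairs_eq]
  have h2 : ∑ i, ∑ j, ∑ a, ∑ b, Z (i, a) (i, b) * Z (j, a) (j, b) =
      ∑ a, ∑ b, (∑ i, Z (i, a) (i, b)) ^ 2 := by
    rw [← sum_comm_pairs]
    simp only [sq, Finset.sum_mul_sum]
  have h3 : ∑ i, ∑ j, ∑ a, ∑ b, ∑ c, ∑ d,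
        (conjMulGram a c b d : ℝ) * (Z (i, a) (i, b) * Z (j, c) (j, d)) =
      ∑ e, (∑ i, ∑ a, ∑ b, (conjMulCoeff e a b : ℝ) * Z (i, a) (i, b)) ^ 2 := by
    have h : ∀ i j, _ := fun i j =>
      sum_conjMulGram_eq (fun a b => Z (i, a) (i, b)) (fun a b => Z (j, a) (j, b))
    simp only [h]
    rw [sum_pair_comm]
    simp only [sq, Finset.sum_mul_sum]
  have h4 : ∀ i j, ∑ a, ∑ b, ∑ c, ∑ d,
        (conjMulGram a c b d : ℝ) * (Z (i, a) (j, b) * Z (j, c) (i, d)) =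
      ∑ e, (∑ a, ∑ b, (conjMulCoeff e a b : ℝ) * Z (i, a) (j, b)) *
          ∑ a, ∑ b, (conjMulCoeff e a b : ℝ) * Z (j, a) (i, b) := fun i j =>
    sum_conjMulGram_eq (fun a b => Z (i, a) (j, b)) (fun a b => Z (j, a) (i, b))
  rw [split]
  simp only [sum_kronecker_fst_12_34, sum_kronecker_fst_14_23]
  simp only [sum_kronecker_13_24, h1, h2, h3, h4]
  simp only [Finset.sum_add_distrib, Finset.sum_sub_distrib,
    ← Finset.mul_sum (s := (Finset.univ : Finset ι))]
  ring

/-- Only the blocks (i, j) and (j, i) interact. Together they give 4 ‖Z_ij + Z_ji‖² - 2⟨u, v⟩, and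
4⟨u, v⟩ ≤ ‖u + v‖² ≤ 8 ‖Z_ij + Z_ji‖² by Bessel. -/
theorem sum_mixedMoment_off_diag_nonneg (Z : ι × Fin 8 → ι × Fin 8 → ℝ) :
    0 ≤ ∑ p, ∑ q, ∑ r, ∑ s, mixedMoment p r q s * (Z p q * Z r s) := by
  rw [sum_mixedMoment_off_diag]
  refine add_nonneg (by positivity) ?_
  set f : ι → ι → ℝ := fun i j => 4 * ∑ a, ∑ b, Z (i, a) (j, b) ^ 2 +
        4 * ∑ a, ∑ b, Z (i, a) (j, b) * Z (j, a) (i, b) -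
        ∑ e, (∑ a, ∑ b, (conjMulCoeff e a b : ℝ) * Z (i, a) (j, b)) *
          ∑ a, ∑ b, (conjMulCoeff e a b : ℝ) * Z (j, a) (i, b) with hf
  have pair : ∀ i j, 0 ≤ f i j + f j i := by
    intro i j
    have bessel := sum_sq_conjMulCoeff_le fun a b => Z (i, a) (j, b) + Z (j, a) (i, b)
    set u : Fin 8 → ℝ := fun e => ∑ a, ∑ b, (conjMulCoeff e a b : ℝ) * Z (i, a) (j, b) with hu
    set v : Fin 8 → ℝ := fun e => ∑ a, ∑ b, (conjMulCoeff e a b : ℝ) * Z (j, a) (i, b) with hv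
    have huv : ∑ e, 4 * (u e * v e) ≤ ∑ e, (∑ a, ∑ b, (conjMulCoeff e a b : ℝ) *
        (Z (i, a) (j, b) + Z (j, a) (i, b))) ^ 2 := by
      refine Finset.sum_le_sum fun e _ => ?_
      simp only [mul_add, Finset.sum_add_distrib]
      nlinarith [sq_nonneg (u e - v e)]
    have e1 : f i j + f j i =
        4 * ∑ a, ∑ b, (Z (i, a) (j, b) + Z (j, a) (i, b)) ^ 2 - 2 * ∑ e, u e * v e := by
      have c1 : ∑ a, ∑ b, Z (j, a) (i, b) * Z (i, a) (j, b) =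
          ∑ a, ∑ b, Z (i, a) (j, b) * Z (j, a) (i, b) := by simp only [mul_comm]
      have c2 : ∑ e, v e * u e = ∑ e, u e * v e := by simp only [mul_comm]
      simp only [hf, add_sq, Finset.sum_add_distrib, mul_assoc, ← Finset.mul_sum]
      simp only [c1]
      linarith
    rw [← Finset.mul_sum] at huv
    linarith
  have sym : ∑ i, ∑ j, f i j = ∑ i, ∑ j, f j i := Finset.sum_comm
  have : 0 ≤ ∑ i, ∑ j, (f i j + f j i) :=
    Finset.sum_nonneg fun i _ => Finset.sum_nonneg fun j _ => pair i j
  simp only [Finset.sum_add_distrib] at this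
  linarith

end MixedContractions

/-! ### Positivity and explicit values of the moment form. -/

section MomentForm

variable {ι : Type*} [Fintype ι] [DecidableEq ι]

/-- The quadratic form on symmetric matrices defined by the moment tensor. -/
def momentForm (Q : (ι × Fin 8) ⊕ (ι × Fin 8) → (ι × Fin 8) ⊕ (ι × Fin 8) → ℝ) : ℝ :=
  ∑ p, ∑ q, ∑ r, ∑ s, moment p q r s * (Q p q * Q r s)

theorem momentForm_eq (Q : (ι × Fin 8) ⊕ (ι × Fin 8) → (ι × Fin 8) ⊕ (ι × Fin 8) → ℝ)
    (hQ : ∀ s t, Q t s = Q s t) :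
    momentForm Q =
      (∑ p, ∑ q, ∑ r, ∑ s, pureMoment p q r s * (Q (.inl p) (.inl q) * Q (.inl r) (.inl s))) +
      (∑ p, ∑ q, ∑ r, ∑ s, pureMoment p q r s * (Q (.inr p) (.inr q) * Q (.inr r) (.inr s))) +
      2 * (∑ p, ∑ q, ∑ r, ∑ s,
        mixedMoment p q r s * (Q (.inl p) (.inl q) * Q (.inr r) (.inr s))) +
      4 * (∑ p, ∑ q, ∑ r, ∑ s,
        mixedMoment p r q s * (Q (.inl p) (.inr q) * Q (.inl r) (.inr s))) := by
  have h1 : ∑ p, ∑ q, ∑ r, ∑ s, mixedMoment r s p q * (Q (.inr p) (.inr q) * Q (.inl r) (.inl s)) =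
      ∑ p, ∑ q, ∑ r, ∑ s, mixedMoment p q r s * (Q (.inl p) (.inl q) * Q (.inr r) (.inr s)) := by
    rw [sum_comm_pairs fun a b c d =>
      mixedMoment a b c d * (Q (.inr c) (.inr d) * Q (.inl a) (.inl b))]
    simp only [mul_comm (Q (.inr _) (.inr _))]
  have swap12 : ∀ f : ι × Fin 8 → ι × Fin 8 → ι × Fin 8 → ι × Fin 8 → ℝ,
      ∑ p, ∑ q, ∑ r, ∑ s, f q p r s = ∑ p, ∑ q, ∑ r, ∑ s, f p q r s := fun f => Finset.sum_comm
  have swap34 : ∀ f : ι × Fin 8 → ι × Fin 8 → ι × Fin 8 → ι × Fin 8 → ℝ,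
      ∑ p, ∑ q, ∑ r, ∑ s, f p q s r = ∑ p, ∑ q, ∑ r, ∑ s, f p q r s := fun f =>
    Finset.sum_congr rfl fun p _ => Finset.sum_congr rfl fun q _ => Finset.sum_comm
  have h2 : ∑ p, ∑ q, ∑ r, ∑ s, mixedMoment p s q r * (Q (.inl p) (.inr q) * Q (.inr r) (.inl s)) =
      ∑ p, ∑ q, ∑ r, ∑ s, mixedMoment p r q s * (Q (.inl p) (.inr q) * Q (.inl r) (.inr s)) := by
    rw [← swap34]
    simp only [hQ (.inl _) (.inr _)]
  have h3 : ∑ p, ∑ q, ∑ r, ∑ s, mixedMoment q r p s * (Q (.inr p) (.inl q) * Q (.inl r) (.inr s)) =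
      ∑ p, ∑ q, ∑ r, ∑ s, mixedMoment p r q s * (Q (.inl p) (.inr q) * Q (.inl r) (.inr s)) := by
    rw [← swap12]
    simp only [hQ (.inl _) (.inr _)]
  have h4 : ∑ p, ∑ q, ∑ r, ∑ s, mixedMoment q s p r * (Q (.inr p) (.inl q) * Q (.inr r) (.inl s)) =
      ∑ p, ∑ q, ∑ r, ∑ s, mixedMoment p r q s * (Q (.inl p) (.inr q) * Q (.inl r) (.inr s)) := by
    rw [← swap12, ← swap34]
    simp only [hQ (.inl _) (.inr _)]
  simp only [momentForm, Fintype.sum_sum_type, moment, zero_mul, Finset.sum_const_zero, add_zero,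
    zero_add, Finset.sum_add_distrib, h1, h2, h3, h4]
  ring

theorem momentForm_nonneg (Q : (ι × Fin 8) ⊕ (ι × Fin 8) → (ι × Fin 8) ⊕ (ι × Fin 8) → ℝ)
    (hQ : ∀ s t, Q t s = Q s t) : 0 ≤ momentForm Q := by
  have hz := sum_mixedMoment_off_diag_nonneg fun p q => Q (.inl p) (.inr q)
  rw [momentForm_eq Q hQ, sum_pureMoment _ fun p q => hQ (.inl p) (.inl q),
    sum_pureMoment _ fun p q => hQ (.inr p) (.inr q),
    sum_mixedMoment _ _ fun p q => hQ (.inr p) (.inr q)]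
  set X : ι × Fin 8 → ι × Fin 8 → ℝ := fun p q => Q (.inl p) (.inl q)
  set Y : ι × Fin 8 → ι × Fin 8 → ℝ := fun p q => Q (.inr p) (.inr q)
  have hblock := Finset.sum_nonneg fun i (_ : i ∈ (Finset.univ : Finset ι)) =>
    Finset.sum_nonneg fun j (_ : j ∈ (Finset.univ : Finset ι)) =>
      mixed_block_nonneg (fun a b => X (i, a) (j, b)) (fun a b => Y (i, a) (j, b))
  have hX : 0 ≤ ∑ a, ∑ b, (∑ i, X (i, a) (i, b)) ^ 2 := by positivity
  have hY : 0 ≤ ∑ a, ∑ b, (∑ i, Y (i, a) (i, b)) ^ 2 := by positivity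
  simp only [Finset.sum_add_distrib, ← Finset.mul_sum] at hblock ⊢
  -- With s, t the full traces of X and Y, what remains beyond the blocks includes 6s² + 6t² + 8st =
  -- 4(s + t)² + 2s² + 2t².
  nlinarith [sq_nonneg ((∑ i, ∑ a, X (i, a) (i, a)) + ∑ i, ∑ a, Y (i, a) (i, a)),
    sq_nonneg (∑ i, ∑ a, X (i, a) (i, a)), sq_nonneg (∑ i, ∑ a, Y (i, a) (i, a))]

/-- The Hessian of `x ‖·‖² + y ‖·‖²`. -/
def diagHessian (x y : ℝ) :
    (ι × Fin 8) ⊕ (ι × Fin 8) → (ι × Fin 8) ⊕ (ι × Fin 8) → ℝ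
  | .inl p, .inl q => 2 * x * kronecker p q
  | .inr p, .inr q => 2 * y * kronecker p q
  | _, _ => 0

/-- The Hessian of the `e`-th coordinate of the octonionic pairing. -/
def pairingHessian (e : Fin 8) :
    (ι × Fin 8) ⊕ (ι × Fin 8) → (ι × Fin 8) ⊕ (ι × Fin 8) → ℝ
  | .inl p, .inr q => kronecker p.1 q.1 * conjMulCoeff e p.2 q.2
  | .inr q, .inl p => kronecker p.1 q.1 * conjMulCoeff e p.2 q.2
  | _, _ => 0

/-- With k = card ι, the values needed are 768 k (7k + 8) at (1, 1) and 1280 k² at (1, -1). -/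
theorem momentForm_diagHessian (x y : ℝ) :
    momentForm (diagHessian (ι := ι) x y) =
      (x ^ 2 + y ^ 2) * (1664 * Fintype.card ι ^ 2 + 1536 * Fintype.card ι) +
        x * y * (2048 * Fintype.card ι ^ 2 + 3072 * Fintype.card ι) := by
  have gram : ∀ a b : Fin 8, (conjMulGram a a b b : ℝ) = 1 := by
    intro a b
    have : conjMulGram a a b b = 1 := by revert a b; decide
    exact_mod_cast this
  have sym : ∀ (z : ℝ) (p q : ι × Fin 8), 2 * z * kronecker q p = 2 * z * kronecker p q :=
    fun z p q => by rw [kronecker_comm]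
  rw [momentForm_eq]
  · simp only [diagHessian]
    rw [sum_pureMoment _ (sym x), sum_pureMoment _ (sym y), sum_mixedMoment _ _ (sym y)]
    simp [kronecker, Prod.ext_iff, ite_and, Finset.sum_add_distrib, gram]
    ring
  · rintro (s | s) (t | t) <;> simp [diagHessian, kronecker_comm s]

/-- Here Z is block diagonal, and the sum over i, j cancels as 32k + 32k - 64k. The squares leave
16k² + 64k², and the Z part carries weight 4. -/
theorem momentForm_pairingHessian (e : Fin 8) :
    momentForm (pairingHessian (ι := ι) e) = 320 * Fintype.card ι ^ 2 := by
  have orth : ∀ f, ∑ a, ∑ b, (conjMulCoeff f a b : ℝ) * conjMulCoeff e a b =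
      if f = e then 8 else 0 := by
    intro f
    have : ∑ a, ∑ b, conjMulCoeff f a b * conjMulCoeff e a b = if f = e then 8 else 0 := by
      revert e f; decide +kernel
    exact_mod_cast this
  rw [momentForm_eq]
  · simp only [pairingHessian]
    rw [sum_mixedMoment_off_diag]
    have sq_coeff := orth e
    simp only [← sq, if_true] at sq_coeff
    simp [kronecker, Finset.sum_add_distrib, orth, mul_pow, ← Finset.mul_sum, ← sq, sq_coeff,
      eq_comm (b := e)]
    ring
  · rintro (s | s) (t | t) <;> rfl

end MomentForm

/-! ### The quartic functional on sums of squares. -/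

section QuarticFunctional

open MvPolynomial

variable {σ : Type*}

/-- The Hessian of a polynomial at the origin. -/
noncomputable def hessianAtZero (f : MvPolynomial σ ℝ) (s t : σ) : ℝ :=
  constantCoeff (pderiv s (pderiv t f))

theorem pderiv_comm (s t : σ) (f : MvPolynomial σ ℝ) :
    pderiv t (pderiv s f) = pderiv s (pderiv t f) := by
  have h : ⁅pderiv (R := ℝ) t, pderiv (R := ℝ) s⁆ = 0 := by
    refine MvPolynomial.derivation_ext fun i => ?_
    classical
    simp [Derivation.commutator_apply, pderiv_X, Pi.single_apply, apply_ite (pderiv _)]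
  have h' := congrArg (fun D : Derivation ℝ (MvPolynomial σ ℝ) (MvPolynomial σ ℝ) => D f) h
  simpa [Derivation.commutator_apply, sub_eq_zero] using h'

theorem hessianAtZero_comm (f : MvPolynomial σ ℝ) (s t : σ) :
    hessianAtZero f t s = hessianAtZero f s t := by
  rw [hessianAtZero, hessianAtZero, pderiv_comm]

theorem hessianAtZero_mul_self (f : MvPolynomial σ ℝ) (s : σ) :
    hessianAtZero (f * f) s s =
      2 * (constantCoeff f * hessianAtZero f s s + constantCoeff (pderiv s f) ^ 2) := by
  simp only [hessianAtZero, Derivation.leibniz, smul_eq_mul, map_add, map_mul]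
  ring

variable [Fintype σ]

/-- The fourth-order differential operator at the origin with coefficient tensor `m`. -/
noncomputable def quarticFunctional (m : σ → σ → σ → σ → ℝ) : MvPolynomial σ ℝ →ₗ[ℝ] ℝ where
  toFun f := ∑ p, ∑ q, ∑ r, ∑ s,
    m p q r s * constantCoeff (pderiv p (pderiv q (pderiv r (pderiv s f))))
  map_add' f g := by simp only [map_add, mul_add, Finset.sum_add_distrib]
  map_smul' c f := by
    simp only [Derivation.map_smul, constantCoeff_smul, smul_eq_mul, RingHom.id_apply,
      Finset.mul_sum, mul_left_comm]

/-- A fourth derivative of f² at 0 splits as 2 times the sum over the three pairings of the indices;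
symmetry of m makes these equal, giving 6. -/
theorem quarticFunctional_mul_self (m : σ → σ → σ → σ → ℝ)
    (hmid : ∀ p q r s, m p r q s = m p q r s)
    (hright : ∀ p q r s, m p q s r = m p q r s) (f : MvPolynomial σ ℝ)
    (h0 : constantCoeff f = 0) (h1 : ∀ s, constantCoeff (pderiv s f) = 0) :
    quarticFunctional m (f * f) =
      6 * ∑ p, ∑ q, ∑ r, ∑ s, m p q r s * (hessianAtZero f p q * hessianAtZero f r s) := by
  have h2 : ∀ p q r s, constantCoeff (pderiv p (pderiv q (pderiv r (pderiv s (f * f))))) =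
      2 * (hessianAtZero f p q * hessianAtZero f r s + hessianAtZero f p r * hessianAtZero f q s +
        hessianAtZero f p s * hessianAtZero f q r) := by
    intro p q r s
    simp only [hessianAtZero, Derivation.leibniz, smul_eq_mul, map_add, map_mul, h0, h1]
    ring
  have h3 : ∑ p, ∑ q, ∑ r, ∑ s, m p q r s * (hessianAtZero f p r * hessianAtZero f q s) =
      ∑ p, ∑ q, ∑ r, ∑ s, m p q r s * (hessianAtZero f p q * hessianAtZero f r s) := by
    refine Finset.sum_congr rfl fun p _ => ?_
    rw [Finset.sum_comm]
    simp only [hmid]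
  have h4 : ∑ p, ∑ q, ∑ r, ∑ s, m p q r s * (hessianAtZero f p s * hessianAtZero f q r) =
      ∑ p, ∑ q, ∑ r, ∑ s, m p q r s * (hessianAtZero f p r * hessianAtZero f q s) := by
    refine Finset.sum_congr rfl fun p _ => Finset.sum_congr rfl fun q _ => ?_
    rw [Finset.sum_comm]
    simp only [hright]
  have h5 : quarticFunctional m (f * f) =
      2 * (∑ p, ∑ q, ∑ r, ∑ s, m p q r s * (hessianAtZero f p q * hessianAtZero f r s)) +
      2 * (∑ p, ∑ q, ∑ r, ∑ s, m p q r s * (hessianAtZero f p r * hessianAtZero f q s)) +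
      2 * (∑ p, ∑ q, ∑ r, ∑ s, m p q r s * (hessianAtZero f p s * hessianAtZero f q r)) := by
    simp only [quarticFunctional, LinearMap.coe_mk, AddHom.coe_mk, h2, Finset.mul_sum,
      ← Finset.sum_add_distrib]
    refine Finset.sum_congr rfl fun p _ => Finset.sum_congr rfl fun q _ =>
      Finset.sum_congr rfl fun r _ => Finset.sum_congr rfl fun s _ => by ring
  rw [h5, h4, h3]
  ring

/-- The summands are squares of arbitrary polynomials. Vanishing of the constant term and of the
diagonal Hessian of f forces every summand's root to start in degree 2, and only its Hessian then
matters. -/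
theorem IsSumSq.quarticFunctional_nonneg (m : σ → σ → σ → σ → ℝ)
    (hmid : ∀ p q r s, m p r q s = m p q r s)
    (hright : ∀ p q r s, m p q s r = m p q r s)
    (hpos : ∀ Q : σ → σ → ℝ, (∀ s t, Q t s = Q s t) →
      0 ≤ ∑ p, ∑ q, ∑ r, ∑ s, m p q r s * (Q p q * Q r s))
    {f : MvPolynomial σ ℝ} (hf : IsSumSq f) (h0 : constantCoeff f = 0)
    (h2 : ∀ s, hessianAtZero f s s = 0) : 0 ≤ quarticFunctional m f := by
  -- The signs are carried through the induction because a zero sum of nonnegative terms makes each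
  -- term zero.
  suffices H : 0 ≤ constantCoeff f ∧ (constantCoeff f = 0 → (∀ s, 0 ≤ hessianAtZero f s s) ∧
      ((∀ s, hessianAtZero f s s = 0) → 0 ≤ quarticFunctional m f)) from (H.2 h0).2 h2
  clear h0 h2
  induction hf with
  | zero => simp [hessianAtZero]
  | sq_add a _ ih =>
    rename_i g _
    obtain ⟨ih0, ih1⟩ := ih
    rw [map_add, map_mul]
    refine ⟨add_nonneg (mul_self_nonneg _) ih0, fun h => ?_⟩
    have hg : constantCoeff g = 0 := by nlinarith [mul_self_nonneg (constantCoeff a)]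
    have ha : constantCoeff a = 0 := by nlinarith
    obtain ⟨ih1, ih2⟩ := ih1 hg
    have hadd : ∀ s, hessianAtZero (a * a + g) s s =
        2 * constantCoeff (pderiv s a) ^ 2 + hessianAtZero g s s := by
      intro s
      have : hessianAtZero (a * a + g) s s = hessianAtZero (a * a) s s + hessianAtZero g s s := by
        simp only [hessianAtZero, map_add]
      rw [this, hessianAtZero_mul_self, ha, zero_mul, zero_add]
    refine ⟨fun s => ?_, fun hz => ?_⟩
    · rw [hadd]
      exact add_nonneg (by positivity) (ih1 s)
    · have hs : ∀ s, constantCoeff (pderiv s a) = 0 ∧ hessianAtZero g s s = 0 := by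
        intro s
        have e := hz s
        rw [hadd] at e
        have e1 := ih1 s
        have e2 := sq_nonneg (constantCoeff (pderiv s a))
        exact ⟨pow_eq_zero_iff two_ne_zero |>.1 (by linarith), by linarith⟩
      rw [map_add, quarticFunctional_mul_self m hmid hright a ha fun s => (hs s).1]
      exact add_nonneg (mul_nonneg (by norm_num) (hpos _ fun s t => hessianAtZero_comm a s t))
        (ih2 fun s => (hs s).2)

end QuarticFunctional

/-! ### Upper bound on the sos levels of the Cauchy-Schwarz form. -/

section SosBound

open MvPolynomial

theorem constantCoeff_pderiv_X_mul_X {σ : Type*} (u v s : σ) :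
    constantCoeff (pderiv s (X u * X v : MvPolynomial σ ℝ)) = 0 := by
  simp [Derivation.leibniz]

theorem hessianAtZero_X_mul_X {σ : Type*} [DecidableEq σ] (u v s t : σ) :
    hessianAtZero (X u * X v : MvPolynomial σ ℝ) s t =
      kronecker s u * kronecker t v + kronecker s v * kronecker t u := by
  have h : ∀ a b : σ, constantCoeff (pderiv a (X b : MvPolynomial σ ℝ)) = kronecker a b := by
    intro a b
    by_cases hab : a = b <;> simp [pderiv_X, kronecker, hab, eq_comm (a := b)]
  have h' : ∀ a b c : σ, constantCoeff (pderiv c (pderiv a (X b : MvPolynomial σ ℝ))) = 0 := by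
    intro a b c
    by_cases hab : b = a <;> simp [pderiv_X, hab]
  simp only [hessianAtZero, Derivation.leibniz, smul_eq_mul, map_add, map_mul, h, h',
    constantCoeff_X]
  ring

theorem vecNormSq_xVec (k : ℕ) :
    vecNormSq (xVec k) = ∑ i, ∑ c, X (Sum.inl (i, c)) * X (Sum.inl (i, c)) := by
  simp only [vecNormSq, normSq, xVec, sq]

theorem vecNormSq_yVec (k : ℕ) :
    vecNormSq (yVec k) = ∑ i, ∑ c, X (Sum.inr (i, c)) * X (Sum.inr (i, c)) := by
  simp only [vecNormSq, normSq, yVec, sq]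

theorem sum_X_sq (k : ℕ) :
    ∑ s : Vars k, (X s : MvPolynomial (Vars k) ℝ) ^ 2 =
      vecNormSq (xVec k) + vecNormSq (yVec k) := by
  simp only [vecNormSq_xVec, vecNormSq_yVec, Fintype.sum_sum_type, Fintype.sum_prod_type, sq]

theorem pairing_xVec_yVec (k : ℕ) (e : Fin 8) :
    pairing (xVec k) (yVec k) e =
      ∑ i, ∑ a, ∑ c, C (conjMulCoeff e a c : ℝ) * (X (Sum.inl (i, a)) * X (Sum.inr (i, c))) := by
  simp only [pairing, Finset.sum_apply, mul_conj_apply, xVec, yVec, map_intCast]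

/-- The combination `x ‖·‖² + y ‖·‖²` of the two squared norms. -/
noncomputable def diagForm (k : ℕ) (x y : ℝ) : MvPolynomial (Vars k) ℝ :=
  C x * vecNormSq (xVec k) + C y * vecNormSq (yVec k)

theorem constantCoeff_diagForm (k : ℕ) (x y : ℝ) : constantCoeff (diagForm k x y) = 0 := by
  simp [diagForm, vecNormSq_xVec, vecNormSq_yVec]

theorem constantCoeff_pderiv_diagForm (k : ℕ) (x y : ℝ) (s : Vars k) :
    constantCoeff (pderiv s (diagForm k x y)) = 0 := by
  simp only [diagForm, vecNormSq_xVec, vecNormSq_yVec, map_add, pderiv_C_mul, map_sum,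
    map_mul, constantCoeff_pderiv_X_mul_X]
  simp

theorem hessianAtZero_diagForm (k : ℕ) (x y : ℝ) :
    hessianAtZero (diagForm k x y) = diagHessian x y := by
  have h : ∀ s t, hessianAtZero (diagForm k x y) s t =
      x * ∑ p, hessianAtZero (X (Sum.inl p) * X (Sum.inl p)) s t +
      y * ∑ p, hessianAtZero (X (Sum.inr p) * X (Sum.inr p)) s t := by
    intro s t
    simp only [hessianAtZero, diagForm, vecNormSq_xVec, vecNormSq_yVec, map_add, pderiv_C_mul,
      map_sum, map_mul, constantCoeff_C, Fintype.sum_prod_type]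
  funext s t
  rw [h]
  rcases s with s | s <;> rcases t with t | t <;>
    simp [hessianAtZero_X_mul_X, kronecker, diagHessian, Finset.sum_add_distrib] <;>
    split_ifs <;> ring

theorem constantCoeff_pairing (k : ℕ) (e : Fin 8) :
    constantCoeff (pairing (xVec k) (yVec k) e) = 0 := by
  simp [pairing_xVec_yVec]

theorem constantCoeff_pderiv_pairing (k : ℕ) (e : Fin 8) (s : Vars k) :
    constantCoeff (pderiv s (pairing (xVec k) (yVec k) e)) = 0 := by
  simp only [pairing_xVec_yVec, pderiv_C_mul, map_sum, map_mul,
    constantCoeff_pderiv_X_mul_X]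
  simp

theorem hessianAtZero_pairing (k : ℕ) (e : Fin 8) :
    hessianAtZero (pairing (xVec k) (yVec k) e) = pairingHessian e := by
  have h : ∀ s t, hessianAtZero (pairing (xVec k) (yVec k) e) s t =
      ∑ i, ∑ a, ∑ c, (conjMulCoeff e a c : ℝ) *
        hessianAtZero (X (Sum.inl (i, a)) * X (Sum.inr (i, c))) s t := by
    intro s t
    simp only [hessianAtZero, pairing_xVec_yVec, pderiv_C_mul, map_sum, map_mul,
      constantCoeff_C]
  funext s t
  rw [h]
  rcases s with ⟨i, a⟩ | ⟨i, a⟩ <;> rcases t with ⟨j, b⟩ | ⟨j, b⟩ <;>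
    simp [hessianAtZero_X_mul_X, kronecker, pairingHessian, ite_and, eq_comm (a := j)]

/-- Polarising ‖x‖² ‖y‖² leaves only squares of quadratic forms, on which the functional is already
known. -/
theorem csForm_eq (k : ℕ) :
    csForm k = C (1 / 4) * (diagForm k 1 1 * diagForm k 1 1) -
      C (1 / 4) * (diagForm k 1 (-1) * diagForm k 1 (-1)) -
      ∑ e, pairing (xVec k) (yVec k) e * pairing (xVec k) (yVec k) e := by
  have h : (C (1 / 4) : MvPolynomial (Vars k) ℝ) * 4 = 1 := by
    rw [← map_ofNat C 4, ← C_mul]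
    norm_num
  simp only [csForm, cauchySchwarz, diagForm, normSq, sq, C_1, C_neg]
  linear_combination (-vecNormSq (xVec k) * vecNormSq (yVec k)) * h

theorem le_of_mem_sosLevels_csForm (k : ℕ) (hk : 1 ≤ k) {γ : ℝ}
    (hγ : γ ∈ sosLevels 2 (csForm k)) : γ ≤ -(2 * (k - 1) / (7 * k + 8)) := by
  have hk' : (1 : ℝ) ≤ k := by exact_mod_cast hk
  have hsq : (∑ s : Vars k, (X s : MvPolynomial (Vars k) ℝ) ^ 2) ^ 2 =
      diagForm k 1 1 * diagForm k 1 1 := by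
    rw [sum_X_sq, diagForm, C_1, one_mul, one_mul, sq]
  have hf : IsSumSq (csForm k - C γ * (diagForm k 1 1 * diagForm k 1 1)) := by
    rw [← hsq]
    exact hγ
  have hL := fun f h0 h1 => quarticFunctional_mul_self (σ := Vars k) moment
    moment_swap_mid moment_swap_right f h0 h1
  have hLd : ∀ y, quarticFunctional moment (diagForm k 1 y * diagForm k 1 y) =
      6 * momentForm (diagHessian (ι := Fin k) 1 y) := by
    intro y
    rw [hL _ (constantCoeff_diagForm k 1 y) (constantCoeff_pderiv_diagForm k 1 y),
      hessianAtZero_diagForm]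
    rfl
  have hLp : ∀ e, quarticFunctional moment
      (pairing (xVec k) (yVec k) e * pairing (xVec k) (yVec k) e) =
      6 * momentForm (pairingHessian (ι := Fin k) e) := by
    intro e
    rw [hL _ (constantCoeff_pairing k e) (constantCoeff_pderiv_pairing k e),
      hessianAtZero_pairing]
    rfl
  have h := hf.quarticFunctional_nonneg moment moment_swap_mid moment_swap_right
    (fun Q hQ => momentForm_nonneg Q hQ)
    (by simp [csForm_eq, constantCoeff_diagForm, constantCoeff_pairing])
    (fun s => by
      simp [hessianAtZero, csForm_eq, constantCoeff_diagForm, constantCoeff_pairing,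
        constantCoeff_pderiv_diagForm, constantCoeff_pderiv_pairing])
  simp only [csForm_eq, map_sub, map_sum, C_mul', map_smul, smul_eq_mul, hLd, hLp,
    momentForm_diagHessian, momentForm_pairingHessian, Fintype.card_fin] at h
  simp only [Finset.sum_const, Finset.card_univ, Fintype.card_fin, nsmul_eq_mul] at h
  rw [← neg_div, le_div_iff₀ (by positivity)]
  have hk0 : (0 : ℝ) < k := by linarith
  -- Up to the common factor 6, the functional is -1536 k (k - 1) on cs and 768 k (7k + 8) on ‖v‖⁴.
  have : 0 ≤ (k : ℝ) * (768 * (-(2 * (k - 1)) - γ * (7 * k + 8))) := by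
    push_cast at h
    linarith
  have := nonneg_of_mul_nonneg_right this hk0
  linarith

end SosBound

/-! ### A convexity criterion for quartic forms. -/

section QuarticConvexity

open MvPolynomial

variable {σ : Type*} [Fintype σ]

theorem MvPolynomial.IsHomogeneous.eval_smul_real {f : MvPolynomial σ ℝ} {n : ℕ}
    (hf : f.IsHomogeneous n) (t : ℝ) (v : σ → ℝ) : eval (t • v) f = t ^ n * eval v f := by
  rw [eval_eq', eval_eq', Finset.mul_sum]
  refine Finset.sum_congr rfl fun d hd => ?_
  have hdeg : ∑ i, d i = n := by
    rw [hf.degree_eq_sum_deg_support hd]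
    exact (Finset.sum_subset (Finset.subset_univ _) (by simp)).symm
  simp only [Pi.smul_apply, smul_eq_mul, mul_pow, Finset.prod_mul_distrib,
    Finset.prod_pow_eq_pow_sum, hdeg]
  ring

theorem MvPolynomial.IsHomogeneous.exists_eval_add_smul {f : MvPolynomial σ ℝ}
    (hf : f.IsHomogeneous 4) (v w : σ → ℝ) : ∃ c₁ c₂ c₃ : ℝ, ∀ t : ℝ,
      eval (v + t • w) f = eval v f + c₁ * t + c₂ * t ^ 2 + c₃ * t ^ 3 + eval w f * t ^ 4 := by
  let g : Polynomial ℝ := MvPolynomial.aeval (fun i =>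
    Polynomial.C (w i) * Polynomial.X + Polynomial.C (v i)) f
  have hdeg : g.natDegree ≤ 4 * 1 :=
    aeval_natDegree_le f hf.totalDegree_le _ fun i => Polynomial.natDegree_linear_le
  have heval : ∀ t, g.eval t = eval (v + t • w) f := by
    intro t
    rw [← Polynomial.coe_evalRingHom, ← MvPolynomial.coe_aeval_eq_eval]
    simp only [g]
    rw [← Polynomial.coe_aeval_eq_evalRingHom, RingHom.coe_coe, ← AlgHom.comp_apply,
      comp_aeval]
    simp only [map_add, map_mul, Polynomial.aeval_X, Polynomial.aeval_C, RingHom.coe_coe]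
    congr 2
    funext i
    simp [mul_comm, add_comm]
  have hpoly : ∀ t, eval (v + t • w) f = g.coeff 0 + g.coeff 1 * t + g.coeff 2 * t ^ 2 +
      g.coeff 3 * t ^ 3 + g.coeff 4 * t ^ 4 := by
    intro t
    rw [← heval, Polynomial.eval_eq_sum_range' (n := 5) (by omega)]
    simp [Finset.sum_range_succ]
  have h0 : g.coeff 0 = eval v f := by
    have := hpoly 0
    simpa using this.symm
  -- Homogeneity gives f(w + s v) = s⁴ f(v + s⁻¹ w) for s ≠ 0; let s tend to 0.
  have h4 : g.coeff 4 = eval w f := by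
    have l1 : Filter.Tendsto (fun s : ℝ => eval (w + s • v) f) (nhdsWithin 0 {0}ᶜ)
        (nhds (eval w f)) := by
      have : Continuous fun s : ℝ => eval (w + s • v) f :=
        (MvPolynomial.continuous_eval f).comp (by fun_prop)
      have := (this.tendsto 0).mono_left (nhdsWithin_le_nhds (s := {0}ᶜ))
      simpa using this
    have l2 : Filter.Tendsto (fun s : ℝ => g.coeff 0 * s ^ 4 + g.coeff 1 * s ^ 3 +
        g.coeff 2 * s ^ 2 + g.coeff 3 * s + g.coeff 4) (nhdsWithin 0 {0}ᶜ)
        (nhds (g.coeff 4)) := by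
      have : Continuous fun s : ℝ => g.coeff 0 * s ^ 4 + g.coeff 1 * s ^ 3 +
        g.coeff 2 * s ^ 2 + g.coeff 3 * s + g.coeff 4 := by fun_prop
      have := (this.tendsto 0).mono_left (nhdsWithin_le_nhds (s := {0}ᶜ))
      simpa using this
    refine tendsto_nhds_unique (l2.congr' ?_) l1
    filter_upwards [self_mem_nhdsWithin] with s hs
    have hs : s ≠ 0 := hs
    have e : w + s • v = s • (v + s⁻¹ • w) := by
      rw [smul_add, smul_smul, mul_inv_cancel₀ hs, one_smul, add_comm]
    rw [e, hf.eval_smul_real, hpoly]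
    field_simp
  exact ⟨g.coeff 1, g.coeff 2, g.coeff 3, fun t => by rw [hpoly, h0, h4]⟩

/-- A quartic form with the stated parallelogram inequality is convex. -/
theorem MvPolynomial.IsHomogeneous.convexOn_of_parallelogram {f : MvPolynomial σ ℝ}
    (hf : f.IsHomogeneous 4) (hnonneg : ∀ v, 0 ≤ eval v f)
    (hpar : ∀ v w, 2 * eval v f + 2 * eval w f ≤ eval (v + w) f + eval (v - w) f) :
    ConvexOn ℝ Set.univ fun v => eval v f := by
  refine ⟨convex_univ, fun x _ y _ a b ha hb hab => ?_⟩
  obtain ⟨c₁, c₂, c₃, hc⟩ := hf.exists_eval_add_smul x (y - x)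
  -- Half the second derivative along the line: the 2 f(w) in the parallelogram inequality cancels
  -- the quartic excess of the second difference with step 1.
  have hsecond : ∀ t, 0 ≤ c₂ + 3 * c₃ * t + 6 * eval (y - x) f * t ^ 2 := by
    intro t
    have h := hpar (x + t • (y - x)) (y - x)
    have e1 : x + t • (y - x) + (y - x) = x + (t + 1) • (y - x) := by module
    have e2 : x + t • (y - x) - (y - x) = x + (t - 1) • (y - x) := by module
    rw [e1, e2, hc, hc, hc] at h
    linarith
  have hcomb : a • x + b • y = x + b • (y - x) := by
    rw [← eq_sub_iff_add_eq] at hab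
    subst hab
    module
  have hy : eval y f = eval x f + c₁ + c₂ + c₃ + eval (y - x) f := by
    have := hc 1
    rw [one_smul, add_sub_cancel] at this
    rw [this]
    ring
  simp only [smul_eq_mul]
  rw [hcomb, hc, hy]
  have ha' : a = 1 - b := by linarith
  have hb1 : b ≤ 1 := by linarith
  subst ha'
  -- The chord lies above the graph by b(1 - b) times this quantity. Taking t = (1 + b)/3 matches
  -- the c₃ term and leaves f(y - x)(1 - b + b²)/3.
  have key : 0 ≤ c₂ + c₃ * (1 + b) + eval (y - x) f * (1 + b + b ^ 2) := by
    have h1 := hsecond ((1 + b) / 3)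
    have h2 : 0 ≤ eval (y - x) f * (1 - b + b ^ 2) :=
      mul_nonneg (hnonneg _) (by nlinarith [sq_nonneg b])
    linarith
  have := mul_nonneg (mul_nonneg hb (sub_nonneg.2 hb1)) key
  linarith

/-- If a quartic form `f` satisfies `0 ≤ f ≤ M ‖·‖⁴`, then `f + M ‖·‖⁴` is convex. -/
theorem MvPolynomial.IsHomogeneous.convexOn_add_norm_pow {f : MvPolynomial σ ℝ}
    (hf : f.IsHomogeneous 4) {M : ℝ} (hM : 0 ≤ M) (hnonneg : ∀ v, 0 ≤ eval v f)
    (hle : ∀ v, eval v f ≤ M * (∑ i, v i ^ 2) ^ 2) :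
    ConvexOn ℝ Set.univ fun v => eval v (f + C M * (∑ i, X i ^ 2) ^ 2) := by
  set q := f + C M * (∑ i : σ, X i ^ 2) ^ 2 with hq
  have hqhom : q.IsHomogeneous 4 := by
    refine hf.add ?_
    have h1 : (∑ i : σ, (X i : MvPolynomial σ ℝ) ^ 2).IsHomogeneous 2 :=
      IsHomogeneous.sum _ _ _ fun i _ => by simpa using (isHomogeneous_X ℝ i).pow 2
    exact (h1.pow 2).C_mul M
  have hqeval : ∀ v, eval v q = eval v f + M * (∑ i, v i ^ 2) ^ 2 := by
    intro v
    simp [hq]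
  have hqnonneg : ∀ v, 0 ≤ eval v q := fun v => by
    rw [hqeval]
    exact add_nonneg (hnonneg v) (by positivity)
  have hsq : ∀ v w : σ → ℝ, ∑ i, (v + w) i ^ 2 =
      ∑ i, v i ^ 2 + 2 * ∑ i, v i * w i + ∑ i, w i ^ 2 := by
    intro v w
    simp only [Pi.add_apply, add_sq, Finset.sum_add_distrib, mul_assoc, Finset.mul_sum]
  have hsq' : ∀ v w : σ → ℝ, ∑ i, (v - w) i ^ 2 =
      ∑ i, v i ^ 2 - 2 * ∑ i, v i * w i + ∑ i, w i ^ 2 := by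
    intro v w
    simp only [Pi.sub_apply, sub_sq, Finset.sum_add_distrib, Finset.sum_sub_distrib, mul_assoc,
      Finset.mul_sum]
  -- With N the common squared norm, the left side is at most 8MN², while the norm terms on the
  -- right equal 8MN² + 8M⟨v, w⟩².
  have hequal : ∀ v w : σ → ℝ, ∑ i, v i ^ 2 = ∑ i, w i ^ 2 →
      2 * eval v q + 2 * eval w q ≤ eval (v + w) q + eval (v - w) q := by
    intro v w hvw
    simp only [hqeval, hsq, hsq', ← hvw]
    have h1 := hle v
    have h2 := hle w
    rw [← hvw] at h2
    have h3 := hnonneg (v + w)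
    have h4 := hnonneg (v - w)
    have h5 : 0 ≤ M * (∑ i, v i * w i) ^ 2 := by positivity
    linarith
  refine hqhom.convexOn_of_parallelogram hqnonneg fun v w => ?_
  have hzero : ∀ v : σ → ℝ, ∑ i, v i ^ 2 = 0 → v = 0 := by
    intro v h
    rw [Finset.sum_eq_zero_iff_of_nonneg fun i _ => sq_nonneg _] at h
    funext i
    simpa using h i
  have heval0 : eval (0 : σ → ℝ) q = 0 := by
    have := hqhom.eval_smul_real 0 0
    simpa using this
  by_cases hw : ∑ i, w i ^ 2 = 0
  · rw [hzero w hw, heval0]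
    simp only [add_zero, sub_zero, mul_zero]
    linarith
  by_cases hv : ∑ i, v i ^ 2 = 0
  · have hneg := hqhom.eval_smul_real (-1) w
    rw [neg_one_smul] at hneg
    rw [hzero v hv, heval0, zero_add, zero_sub, hneg]
    linarith
  have hv' : 0 < ∑ i, v i ^ 2 := lt_of_le_of_ne (by positivity) (Ne.symm hv)
  have hw' : 0 < ∑ i, w i ^ 2 := lt_of_le_of_ne (by positivity) (Ne.symm hw)
  obtain ⟨c₁, c₂, c₃, hc⟩ := hqhom.exists_eval_add_smul v w
  -- The parallelogram inequality for v and t w with t ≠ 0 says only that c₂ ≥ 0, so w may be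
  -- rescaled to the norm of v.
  set h := √((∑ i, v i ^ 2) / ∑ i, w i ^ 2) with hh
  have hpos : 0 < h := Real.sqrt_pos.2 (div_pos hv' hw')
  have hnorm : ∑ i, v i ^ 2 = ∑ i, (h • w) i ^ 2 := by
    simp only [Pi.smul_apply, smul_eq_mul, mul_pow, ← Finset.mul_sum]
    rw [hh, Real.sq_sqrt (div_pos hv' hw').le, div_mul_cancel₀ _ hw]
  have hpar := hequal v (h • w) hnorm
  rw [hqhom.eval_smul_real, hc h, sub_eq_add_neg, ← neg_smul, hc (-h)] at hpar
  have hc₂ : 0 ≤ c₂ := by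
    have : 0 ≤ c₂ * h ^ 2 := by linarith
    exact nonneg_of_mul_nonneg_left this (by positivity)
  have e1 := hc 1
  have e2 := hc (-1)
  rw [one_smul] at e1
  rw [neg_one_smul, ← sub_eq_add_neg] at e2
  rw [e1, e2]
  linarith

end QuarticConvexity

/-! ### Extrema on the sphere, and an explicit sos level. -/

section CauchySchwarz

theorem Octonion.normSq_nonneg (u : Octonion ℝ) : 0 ≤ normSq u := by
  unfold normSq
  positivity

theorem Octonion.normSq_conj {R : Type*} [CommRing R] (u : Octonion R) :
    normSq (conj u) = normSq u := by
  simp [normSq, conj, Fin.sum_univ_eight]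

/-- Triangle inequality in ℝ⁸, multiplicativity of the norm, then Cauchy-Schwarz for the real
vectors |xᵢ| and |yᵢ|. -/
theorem Octonion.normSq_pairing_le {k : ℕ} (x y : Fin k → Octonion ℝ) :
    normSq (pairing x y) ≤ vecNormSq x * vecNormSq y := by
  have hnorm : ∀ u : Octonion ℝ, ‖(WithLp.toLp 2 u : EuclideanSpace ℝ (Fin 8))‖ = √(normSq u) := by
    intro u
    simp [EuclideanSpace.norm_eq, normSq]
  have h1 : √(normSq (pairing x y)) ≤ ∑ i, √(normSq (x i)) * √(normSq (y i)) := by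
    rw [← hnorm, pairing, WithLp.toLp_sum]
    refine (norm_sum_le _ _).trans_eq (Finset.sum_congr rfl fun i _ => ?_)
    rw [hnorm, normSq_mul, normSq_conj, Real.sqrt_mul (normSq_nonneg _)]
  have h2 := Finset.sum_mul_sq_le_sq_mul_sq Finset.univ (fun i => √(normSq (x i)))
    fun i => √(normSq (y i))
  simp only [Real.sq_sqrt (normSq_nonneg _)] at h2
  calc normSq (pairing x y) = √(normSq (pairing x y)) ^ 2 :=
        (Real.sq_sqrt (normSq_nonneg _)).symm
    _ ≤ (∑ i, √(normSq (x i)) * √(normSq (y i))) ^ 2 :=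
        pow_le_pow_left₀ (Real.sqrt_nonneg _) h1 2
    _ ≤ _ := h2

open MvPolynomial

theorem sum_sq_eq_vecNormSq {k : ℕ} (v : Vars k → ℝ) :
    ∑ s, v s ^ 2 = vecNormSq (fun i c => v (Sum.inl (i, c))) +
      vecNormSq (fun i c => v (Sum.inr (i, c))) := by
  simp only [vecNormSq, normSq, Fintype.sum_sum_type, Fintype.sum_prod_type]

theorem eval_csForm_nonneg {k : ℕ} (v : Vars k → ℝ) : 0 ≤ eval v (csForm k) := by
  rw [eval_csForm, cauchySchwarz, sub_nonneg]
  exact normSq_pairing_le _ _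

theorem eval_csForm_le {k : ℕ} (v : Vars k → ℝ) :
    eval v (csForm k) ≤ 1 / 4 * (∑ s, v s ^ 2) ^ 2 := by
  rw [eval_csForm, cauchySchwarz, sum_sq_eq_vecNormSq]
  set x := vecNormSq fun i c => v (Sum.inl (i, c))
  set y := vecNormSq fun i c => v (Sum.inr (i, c))
  nlinarith [sq_nonneg (x - y),
    normSq_nonneg (pairing (fun i c => v (Sum.inl (i, c))) (fun i c => v (Sum.inr (i, c))))]

theorem Octonion.vecNormSq_single {k : ℕ} (i : Fin k) (u : Octonion ℝ) :
    vecNormSq (Pi.single i u) = normSq u := by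
  rw [vecNormSq, Finset.sum_eq_single i]
  · simp
  · intro j _ hj
    simp [normSq, Pi.single_eq_of_ne hj]
  · simp

theorem Octonion.normSq_single (r : ℝ) : normSq (Pi.single 0 r : Octonion ℝ) = r ^ 2 := by
  simp [normSq, Pi.single_apply]

theorem Octonion.mul_zero' (u : Octonion ℝ) : mul u 0 = 0 := by
  funext i
  fin_cases i <;> simp [mul, rightMul, Matrix.mulVec, dotProduct, Fin.sum_univ_eight]

theorem Octonion.mul_conj_zero (u : Octonion ℝ) : mul (conj 0) u = 0 := by
  have : conj (0 : Octonion ℝ) = 0 := by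
    funext i
    fin_cases i <;> simp [conj]
  rw [this, mul, Matrix.mulVec_zero]

theorem Octonion.pairing_single_single {k : ℕ} {i j : Fin k} (hij : i ≠ j) (u v : Octonion ℝ) :
    pairing (Pi.single i u) (Pi.single j v) = 0 := by
  refine Finset.sum_eq_zero fun l _ => ?_
  by_cases hl : l = i
  · subst hl
    rw [Pi.single_eq_of_ne hij, mul_zero']
  · rw [Pi.single_eq_of_ne hl, mul_conj_zero]

/-- The point with `x = r eᵢ` and `y = s eⱼ`. -/
def twoPoint {k : ℕ} (i j : Fin k) (r s : ℝ) : Vars k → ℝ :=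
  Sum.elim (fun p => (Pi.single i (Pi.single 0 r) : Fin k → Octonion ℝ) p.1 p.2)
    (fun p => (Pi.single j (Pi.single 0 s) : Fin k → Octonion ℝ) p.1 p.2)

theorem sum_sq_twoPoint {k : ℕ} (i j : Fin k) (r s : ℝ) :
    ∑ t, twoPoint i j r s t ^ 2 = r ^ 2 + s ^ 2 := by
  rw [sum_sq_eq_vecNormSq]
  simp only [twoPoint, Sum.elim_inl, Sum.elim_inr]
  rw [vecNormSq_single, vecNormSq_single, normSq_single, normSq_single]

theorem eval_csForm_twoPoint {k : ℕ} {i j : Fin k} (hij : i ≠ j) (r s : ℝ) :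
    eval (twoPoint i j r s) (csForm k) = r ^ 2 * s ^ 2 := by
  rw [eval_csForm, cauchySchwarz]
  simp only [twoPoint, Sum.elim_inl, Sum.elim_inr]
  rw [vecNormSq_single, vecNormSq_single, normSq_single, normSq_single, pairing_single_single hij]
  simp [normSq]

theorem isLeast_sphereValues_csForm {k : ℕ} (hk : 2 ≤ k) :
    IsLeast (sphereValues (csForm k)) 0 := by
  refine ⟨⟨twoPoint ⟨0, by omega⟩ ⟨1, by omega⟩ 1 0, ?_, ?_⟩, ?_⟩
  · rw [sum_sq_twoPoint]
    norm_num
  · rw [eval_csForm_twoPoint (by simp)]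
    norm_num
  · rintro _ ⟨v, _, rfl⟩
    exact eval_csForm_nonneg v

theorem isGreatest_sphereValues_csForm {k : ℕ} (hk : 2 ≤ k) :
    IsGreatest (sphereValues (csForm k)) (1 / 4) := by
  have h : √(1 / 2 : ℝ) ^ 2 = 1 / 2 := Real.sq_sqrt (by norm_num)
  refine ⟨⟨twoPoint ⟨0, by omega⟩ ⟨1, by omega⟩ (√(1 / 2)) (√(1 / 2)), ?_, ?_⟩, ?_⟩
  · rw [sum_sq_twoPoint, h]
    norm_num
  · rw [eval_csForm_twoPoint (by simp), h]
    norm_num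
  · rintro _ ⟨v, hv, rfl⟩
    have := eval_csForm_le v
    rw [hv] at this
    linarith

theorem isHomogeneous_vecNormSq_xVec (k : ℕ) : (vecNormSq (xVec k)).IsHomogeneous 2 := by
  rw [vecNormSq_xVec]
  exact IsHomogeneous.sum _ _ _ fun i _ => IsHomogeneous.sum _ _ _ fun c _ =>
    (isHomogeneous_X ℝ _).mul (isHomogeneous_X ℝ _)

theorem isHomogeneous_vecNormSq_yVec (k : ℕ) : (vecNormSq (yVec k)).IsHomogeneous 2 := by
  rw [vecNormSq_yVec]
  exact IsHomogeneous.sum _ _ _ fun i _ => IsHomogeneous.sum _ _ _ fun c _ =>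
    (isHomogeneous_X ℝ _).mul (isHomogeneous_X ℝ _)

theorem isHomogeneous_csForm (k : ℕ) : (csForm k).IsHomogeneous 4 := by
  refine ((isHomogeneous_vecNormSq_xVec k).mul (isHomogeneous_vecNormSq_yVec k)).sub ?_
  refine IsHomogeneous.sum _ _ _ fun e _ => IsHomogeneous.pow (m := 2) ?_ 2
  rw [pairing_xVec_yVec]
  exact IsHomogeneous.sum _ _ _ fun i _ => IsHomogeneous.sum _ _ _ fun a _ =>
    IsHomogeneous.sum _ _ _ fun c _ =>
      ((isHomogeneous_X ℝ _).mul (isHomogeneous_X ℝ _)).C_mul _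

theorem qForm_eq (k : ℕ) : qForm k = csForm k + C (1 / 4) * (∑ s, X s ^ 2) ^ 2 := by
  rw [sum_X_sq, qForm]

theorem MvPolynomial.isSumSq_C {σ : Type*} {r : ℝ} (hr : 0 ≤ r) :
    IsSumSq (C r : MvPolynomial σ ℝ) := by
  rw [← Real.mul_self_sqrt hr, C_mul]
  exact IsSumSq.mul_self _

/-- Lagrange's identity: the difference is half of ∑ (zᵢ - zⱼ)². -/
theorem MvPolynomial.isSumSq_card_mul_sum_sq_sub_sq_sum {σ ι : Type*} [Fintype ι]
    (z : ι → MvPolynomial σ ℝ) :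
    IsSumSq ((Fintype.card ι : MvPolynomial σ ℝ) * ∑ i, z i ^ 2 - (∑ i, z i) ^ 2) := by
  have h : (Fintype.card ι : MvPolynomial σ ℝ) * ∑ i, z i ^ 2 - (∑ i, z i) ^ 2 =
      C (1 / 2) * ∑ i, ∑ j, (z i - z j) * (z i - z j) := by
    have e : ∑ i, ∑ j, (z i - z j) * (z i - z j) =
        2 * ((Fintype.card ι : MvPolynomial σ ℝ) * ∑ i, z i ^ 2 - (∑ i, z i) ^ 2) := by
      have t : ∀ i j, (z i - z j) * (z i - z j) = z i ^ 2 + z j ^ 2 - 2 * (z i * z j) :=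
        fun i j => by ring
      simp only [t, Finset.sum_add_distrib, Finset.sum_sub_distrib, ← Finset.mul_sum,
        ← Finset.sum_mul, Finset.sum_const, Finset.card_univ, nsmul_eq_mul]
      ring
    have hc : (C (1 / 2) : MvPolynomial σ ℝ) * 2 = 1 := by
      rw [← map_ofNat C 2, ← C_mul]
      norm_num
    rw [e, ← mul_assoc, hc, one_mul]
  rw [h]
  exact (isSumSq_C (by norm_num)).mul
    (IsSumSq.sum fun i _ => IsSumSq.sum fun j _ => IsSumSq.mul_self _)

/-- A crude level, needed only so that the set of levels is nonempty. It rests on |∑ x̄ᵢ yᵢ|² ≤ k ∑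
|xᵢ|² |yᵢ|², with a difference that is a sum of squares coordinate by coordinate. -/
theorem neg_mem_sosLevels_csForm (k : ℕ) : -(k : ℝ) ∈ sosLevels 2 (csForm k) := by
  have hx : ∀ i, IsSumSq (normSq (xVec k i)) := fun i => IsSumSq.sum_sq _ _
  have hy : ∀ i, IsSumSq (normSq (yVec k i)) := fun i => IsSumSq.sum_sq _ _
  have hX : IsSumSq (vecNormSq (xVec k)) := IsSumSq.sum fun i _ => hx i
  have hY : IsSumSq (vecNormSq (yVec k)) := IsSumSq.sum fun i _ => hy i
  have hk : IsSumSq (k : MvPolynomial (Vars k) ℝ) := IsSumSq.natCast k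
  let z : Fin k → Octonion (MvPolynomial (Vars k) ℝ) := fun i => mul (conj (xVec k i)) (yVec k i)
  have hz : IsSumSq ((k : MvPolynomial (Vars k) ℝ) * ∑ i, normSq (xVec k i) * normSq (yVec k i) -
      normSq (pairing (xVec k) (yVec k))) := by
    have e : (k : MvPolynomial (Vars k) ℝ) * ∑ i, normSq (xVec k i) * normSq (yVec k i) -
        normSq (pairing (xVec k) (yVec k)) =
        ∑ e, ((Fintype.card (Fin k) : MvPolynomial (Vars k) ℝ) * ∑ i, z i e ^ 2 -
          (∑ i, z i e) ^ 2) := by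
      have e1 : ∑ i, normSq (xVec k i) * normSq (yVec k i) = ∑ e, ∑ i, z i e ^ 2 := by
        rw [Finset.sum_comm]
        refine Finset.sum_congr rfl fun i _ => ?_
        rw [← normSq_conj (xVec k i), ← normSq_mul, normSq]
      rw [e1, Finset.sum_sub_distrib, ← Finset.mul_sum, Fintype.card_fin]
      simp only [normSq, pairing, Finset.sum_apply, z]
    rw [e]
    exact IsSumSq.sum fun e _ => MvPolynomial.isSumSq_card_mul_sum_sq_sub_sq_sum _
  have hoff : IsSumSq (vecNormSq (xVec k) * vecNormSq (yVec k) -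
      ∑ i, normSq (xVec k i) * normSq (yVec k i)) := by
    have e : vecNormSq (xVec k) * vecNormSq (yVec k) -
        ∑ i, normSq (xVec k i) * normSq (yVec k i) =
        ∑ i, normSq (xVec k i) * ∑ j ∈ Finset.univ.erase i, normSq (yVec k j) := by
      rw [vecNormSq, Finset.sum_mul, ← Finset.sum_sub_distrib]
      refine Finset.sum_congr rfl fun i _ => ?_
      rw [vecNormSq, ← Finset.add_sum_erase _ _ (Finset.mem_univ i)]
      ring
    rw [e]
    exact IsSumSq.sum fun i _ => (hx i).mul (IsSumSq.sum fun j _ => hy j)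
  have e : csForm k - C (-(k : ℝ)) * (∑ s, X s ^ 2) ^ 2 =
      vecNormSq (xVec k) * vecNormSq (yVec k) +
      ((k : MvPolynomial (Vars k) ℝ) * ∑ i, normSq (xVec k i) * normSq (yVec k i) -
        normSq (pairing (xVec k) (yVec k))) +
      (k : MvPolynomial (Vars k) ℝ) * (vecNormSq (xVec k) * vecNormSq (xVec k) +
        vecNormSq (yVec k) * vecNormSq (yVec k) +
        vecNormSq (xVec k) * vecNormSq (yVec k) + (vecNormSq (xVec k) * vecNormSq (yVec k) -
          ∑ i, normSq (xVec k i) * normSq (yVec k i))) := by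
    rw [sum_X_sq, csForm, cauchySchwarz, C_neg, map_natCast]
    ring
  change IsSumSq _
  rw [e]
  exact ((hX.mul hY).add hz).add
    (hk.mul ((((IsSumSq.mul_self _).add (IsSumSq.mul_self _)).add (hX.mul hY)).add hoff))

end CauchySchwarz

theorem theorem1 (k : ℕ) (hk : 17 ≤ k) :
    -- `GAP(cs_k)` is built from genuine extrema of a quartic form, and it exceeds `2`
    ((csForm k).IsHomogeneous 4 ∧
      IsLeast (sphereValues (csForm k)) (sphereMin (csForm k)) ∧
      IsGreatest (sphereValues (csForm k)) (sphereMax (csForm k)) ∧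
      sphereMin (csForm k) < sphereMax (csForm k) ∧
      IsLUB (sosLevels 2 (csForm k)) (sosMin 2 (csForm k)) ∧
      2 < gap 2 (csForm k)) ∧
    -- `q_k` is a convex quartic form in `16 k` variables that is not a sum of squares
    (Fintype.card (Vars k) = 16 * k ∧
      (qForm k).IsHomogeneous 4 ∧
      ConvexOn ℝ Set.univ (fun v : Vars k → ℝ => MvPolynomial.eval v (qForm k)) ∧
      ¬ IsSumSq (qForm k)) := by
  have hmin := isLeast_sphereValues_csForm (k := k) (by omega)
  have hmax := isGreatest_sphereValues_csForm (k := k) (by omega)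
  have emin : sphereMin (csForm k) = 0 := hmin.csInf_eq
  have emax : sphereMax (csForm k) = 1 / 4 := hmax.csSup_eq
  have hbound : ∀ γ ∈ sosLevels 2 (csForm k), γ ≤ -(2 * ((k : ℝ) - 1) / (7 * k + 8)) :=
    fun γ hγ => le_of_mem_sosLevels_csForm k (by omega) hγ
  -- Nonemptiness and boundedness make `sSup` a true supremum instead of its default value 0.
  have hlub : IsLUB (sosLevels 2 (csForm k)) (sosMin 2 (csForm k)) :=
    isLUB_csSup ⟨_, neg_mem_sosLevels_csForm k⟩ ⟨_, hbound⟩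
  -- Equivalent to 8(k - 1) > 7k + 8, that is k > 16; at k = 16 there is equality.
  have hlt : -(2 * ((k : ℝ) - 1) / (7 * k + 8)) < -(1 / 4) := by
    have : (17 : ℝ) ≤ k := by exact_mod_cast hk
    rw [neg_lt_neg_iff, div_lt_div_iff₀ (by norm_num) (by positivity)]
    linarith
  have hsos : sosMin 2 (csForm k) < -(1 / 4) := (hlub.2 hbound).trans_lt hlt
  refine ⟨⟨isHomogeneous_csForm k, by rwa [emin], by rwa [emax], ?_, hlub, ?_⟩, ?_, ?_, ?_, ?_⟩
  · rw [emin, emax]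
    norm_num
  · rw [gap, emin, emax, sub_zero, lt_div_iff₀ (by norm_num)]
    linarith
  · simp only [Vars, Fintype.card_sum, Fintype.card_prod, Fintype.card_fin]
    ring
  · exact (isHomogeneous_csForm k).add ((((isHomogeneous_vecNormSq_xVec k).add
      (isHomogeneous_vecNormSq_yVec k)).pow 2).C_mul _)
  · rw [qForm_eq]
    exact (isHomogeneous_csForm k).convexOn_add_norm_pow (by norm_num) eval_csForm_nonneg
      eval_csForm_le
  · intro h
    have hmem : -(1 / 4) ∈ sosLevels 2 (csForm k) := by
      change IsSumSq _
      rwa [MvPolynomial.C_neg, neg_mul, sub_neg_eq_add, ← qForm_eq]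
    exact absurd (hlub.1 hmem) (not_le.2 hsos)
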